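/- Let $M$ be the figure-eight knot complement, with $\pi_1(M)=\langle x,y\mid ax=ya\rangle$, $a=xy^{-1}x^{-1}y$, meridian $x$ and longitude $l=b^{-1}a^{-1}ba$, where $b=xy^{-1}$; $M$ is glued from two ideal tetrahedra. Let $z_1,z_2\in\mathbb C$ with $\operatorname{Im}z_1,\operatorname{Im}z_2>0$ satisfy the gluing equations $$2\operatorname{Log}z_1+\operatorname{Log}\tfrac1{1-z_1}+\operatorname{Log}z_2+2\operatorname{Log}\bigl(1-\tfrac1{z_2}\bigr)=2\pi i,$$ $$\operatorname{Log}\tfrac1{1-z_1}+2\operatorname{Log}\bigl(1-\tfrac1{z_1}\bigr)+\operatorname{Log}z_2+2\operatorname{Log}\tfrac1{1-z_2}=2\pi i .$$ Let $w=z_1(1-z_2)$ and let $\rho_u\colon\pi_1(M)\to \mathrm{PSL}(2,\mathbb C)\cong \mathrm{SO}_0(3,1)\subset\mathrm{GL}(4,\mathbb R)$ be the holonomy of the resulting (possibly incomplete) hyperbolic structure, given by $$\rho_u(x)=\pm\frac1{\sqrt w}\begin{pmatrix}1&-1\\0&w\end{pmatrix},\qquad \rho_u(y)=\pm\frac1{\sqrt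 w}\begin{pmatrix}w&0\\-z_2&1\end{pmatrix}.$$ Let $u=\operatorname{Log}(z_1(1-z_2))$ and $v=2\log\bigl(-(1-z_2)^2/z_2\bigr)$ be the complex lengths of $\rho_u(x)$ and $\rho_u(l)$, with the continuous branches that vanish at the complete structure $z_1=z_2=e^{\pi i/3}$ (so $v=2(2\operatorname{Log}(1-z_2)-\operatorname{Log}z_2+\pi i)$). Let $\mathfrak v$ be the orthogonal complement of $\mathfrak{so}(3,1)$ in $\mathfrak{sl}(4,\mathbb R)$ with respect to the Killing form, and let $\mathfrak v_u$ be $\mathfrak v$ with $\pi_1(M)$ acting by $\operatorname{Ad}\rho_u$. For $g\in\{x,l\}$ let $H^1(g;\mathfrak v_u)$ be the cohomology of the circle $g$, i.e. of $\mathbb Z$ acting through $n\mapsto g^n$. Suppose that $\dim H^1(M;\mathfrak v_u)=1$, that the restrictions $\mathrm{res}_x\colon H^1(M;\mathfrak v_u)\to H^1(x;\mathfrak v_u)$ and $\mathrm{res}_l\colon H^1(M;\mathfrak v_u)\to H^1(l;\mathfrak v_u)$ are both isomorphisms, and that relatively prime integers $(p,q)$ are generalized Dehn filling coefficients of $\rho_u$,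 i.e. $pu+qv=2\pi i$. Then the slope $s_u$ of the representation is well defined: there is exactly one real number $s_u$ of the form $c_1/c_2$, where $a_u$ is a basis vector of $\mathfrak v_u^x=\mathfrak v_u^l$, $z$ is a crossed homomorphism representing a nonzero class of $H^1(M;\mathfrak v_u)$, and $c_1,c_2\in\mathbb R$ are such that $z(x)-c_1a_u\in\operatorname{im}(1-x)$ and $z(l)-c_2a_u\in\operatorname{im}(1-l)$. Let $M_{p,q}$ be the $(p,q)$-Dehn filling of $M$, with $\pi_1(M_{p,q})=\pi_1(M)/\langle\langle x^pl^q\rangle\rangle$. If $s_u\neq -q/p$ (when $p=0$ this condition is to be read as satisfied), then $\rho_u$ descends to a homomorphism $\sigma\colon\pi_1(M_{p,q})\to\mathrm{SO}(3,1)$, and $M_{p,q}$ is infinitesimally projectively rigid, that is, $H^1(\pi_1(M_{p,q});\mathfrak{sl}(4,\mathbb R)_{\operatorname{Ad}\sigma})=0$; in particular $H^1(M_{p,q};\mathfrak v_u)=0$. -/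

import Mathlib

open Matrix

noncomputable section

namespace FigEight

/-! ### The group of the figure-eight knot complement -/

/-- The free generator `x`. -/
def fx : FreeGroup (Fin 2) := FreeGroup.of 0

/-- The free generator `y`. -/
def fy : FreeGroup (Fin 2) := FreeGroup.of 1

/-- The word `a = x y⁻¹ x⁻¹ y`. -/
def fa : FreeGroup (Fin 2) := fx * fy⁻¹ * fx⁻¹ * fy

/-- The fundamental group `⟨x, y | a x = y a⟩`, `a = x y⁻¹ x⁻¹ y`, of the figure-eight knot
complement `M`. -/
abbrev KnotGroup : Type := PresentedGroup ({fa * fx * (fy * fa)⁻¹} : Set (FreeGroup (Fin 2)))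

/-- The meridian. -/
def x : KnotGroup := PresentedGroup.of 0

/-- The second Wirtinger generator. -/
def y : KnotGroup := PresentedGroup.of 1

def a : KnotGroup := x * y⁻¹ * x⁻¹ * y

def b : KnotGroup := x * y⁻¹

/-- The longitude. -/
def l : KnotGroup := b⁻¹ * a⁻¹ * b * a

/-- The fundamental group of the `(p, q)`-Dehn filling `M_{p,q}`: the curve `x ^ p l ^ q` is
filled by a disc. -/
abbrev FilledGroup (p q : ℤ) : Type :=
  KnotGroup ⧸ Subgroup.normalClosure ({x ^ p * l ^ q} : Set KnotGroup)

/-! ### Hyperbolic structures on `M` from two ideal tetrahedra -/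

/-- Shapes of two positively oriented ideal tetrahedra satisfying the edge equations of the
two-tetrahedra triangulation of the figure-eight knot complement. -/
structure Shapes where
  z₁ : ℂ
  z₂ : ℂ
  im_pos₁ : 0 < z₁.im
  im_pos₂ : 0 < z₂.im
  edge₁ : 2 * Complex.log z₁ + Complex.log (1 / (1 - z₁)) + Complex.log z₂
    + 2 * Complex.log (1 - 1 / z₂) = 2 * Real.pi * Complex.I
  edge₂ : Complex.log (1 / (1 - z₁)) + 2 * Complex.log (1 - 1 / z₁) + Complex.log z₂
    + 2 * Complex.log (1 / (1 - z₂)) = 2 * Real.pi * Complex.I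

namespace Shapes

variable (S : Shapes)

/-- The derivative `z₁ (1 - z₂)` of the holonomy of the meridian. -/
def w : ℂ := S.z₁ * (1 - S.z₂)

/-- The complex length of the meridian, `log (z₁ (1 - z₂))`; the branch vanishes at the complete
structure and is continuous, since the argument of `z₁ (1 - z₂)` stays in `(-π, π)`. -/
def u : ℂ := Complex.log (S.z₁ * (1 - S.z₂))

/-- The complex length `2 log (-(1 - z₂)² / z₂)` of the longitude, with the continuous branch of
the logarithm that vanishes at the complete structure `z₁ = z₂ = exp (π i / 3)`. -/
def v : ℂ :=
  2 * (2 * Complex.log (1 - S.z₂) - Complex.log S.z₂ + Real.pi * Complex.I)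

/-- `(p, q)` are generalized Dehn filling coefficients of the structure. -/
def IsDehnFillingCoeff (p q : ℝ) : Prop :=
  (p : ℂ) * S.u + (q : ℂ) * S.v = 2 * Real.pi * Complex.I

lemma z₁_ne : S.z₁ ≠ 0 := fun h => by simpa [h] using S.im_pos₁

lemma z₂_ne : S.z₂ ≠ 0 := fun h => by simpa [h] using S.im_pos₂

lemma one_sub_z₁_ne : 1 - S.z₁ ≠ 0 := fun h => by
  have := S.im_pos₁
  rw [← sub_eq_zero.1 h] at this
  simp at this

lemma one_sub_z₂_ne : 1 - S.z₂ ≠ 0 := fun h => by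
  have := S.im_pos₂
  rw [← sub_eq_zero.1 h] at this
  simp at this

lemma w_ne : S.w ≠ 0 := mul_ne_zero S.z₁_ne S.one_sub_z₂_ne

lemma w_sq : S.w ^ 2 = (1 - S.z₁) * S.z₂ := by
  have h1 := S.z₁_ne
  have h2 := S.z₂_ne
  have h3 := S.one_sub_z₁_ne
  have h4 := S.one_sub_z₂_ne
  have h5 : 1 - 1 / S.z₂ ≠ 0 := by
    intro h
    apply h4
    field_simp at h
    linear_combination -h
  have e := congrArg Complex.exp S.edge₁
  rw [Complex.exp_two_pi_mul_I, Complex.exp_add, Complex.exp_add, Complex.exp_add,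
    two_mul, two_mul, Complex.exp_add, Complex.exp_add, Complex.exp_log h1,
    Complex.exp_log (one_div_ne_zero h3), Complex.exp_log h2, Complex.exp_log h5] at e
  field_simp at e
  rw [w]
  linear_combination e

/-- A representative in `GL(2, ℂ)` of the holonomy of `x`, an element of `PGL(2, ℂ) = PSL(2, ℂ)`;
division by `√w` gives the one of determinant one. -/
def matX : GL (Fin 2) ℂ :=
  GeneralLinearGroup.mkOfDetNeZero !![1, -1; 0, S.w] (by simp [det_fin_two, S.w_ne])

/-- A representative in `GL(2, ℂ)` of the holonomy of `y`; division by `√w` gives the one of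
determinant one. -/
def matY : GL (Fin 2) ℂ :=
  GeneralLinearGroup.mkOfDetNeZero !![S.w, 0; -S.z₂, 1] (by simp [det_fin_two, S.w_ne])

lemma rel_aux : S.w - (S.z₂ + S.w - S.w ^ 2) * (1 - S.z₂) = 0 := by
  have h := S.w_sq
  have h' : S.w = S.z₁ * (1 - S.z₂) := rfl
  linear_combination (1 - S.z₂) * (h - h') + h'

lemma matX_inv : ((S.matX⁻¹ : GL (Fin 2) ℂ) : Matrix (Fin 2) (Fin 2) ℂ)
    = !![1, S.w⁻¹; 0, S.w⁻¹] := by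
  rw [coe_units_inv]
  apply inv_eq_right_inv
  have := S.w_ne
  ext i j
  fin_cases i <;> fin_cases j <;>
    simp [matX, GeneralLinearGroup.mkOfDetNeZero, Matrix.mul_apply, this]

lemma matY_inv : ((S.matY⁻¹ : GL (Fin 2) ℂ) : Matrix (Fin 2) (Fin 2) ℂ)
    = !![S.w⁻¹, 0; S.z₂ * S.w⁻¹, 1] := by
  rw [coe_units_inv]
  apply inv_eq_right_inv
  have := S.w_ne
  ext i j
  fin_cases i <;> fin_cases j <;>
    simp [matY, GeneralLinearGroup.mkOfDetNeZero, Matrix.mul_apply, this]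

lemma mat_rel : S.matX * S.matY⁻¹ * S.matX⁻¹ * S.matY * S.matX
    = S.matY * (S.matX * S.matY⁻¹ * S.matX⁻¹ * S.matY) := by
  have hw := S.w_ne
  have h := S.rel_aux
  apply Units.ext
  simp only [Units.val_mul, matX_inv, matY_inv]
  simp only [matX, matY, GeneralLinearGroup.mkOfDetNeZero]
  ext i j
  fin_cases i <;> fin_cases j <;> simp [Matrix.mul_apply, Fin.sum_univ_two] <;> field_simp
  · linear_combination (1 - S.w) * h
  · linear_combination -h
  · right
    linear_combination h
  · linear_combination (S.w - 1) * h

/-- The holonomy `π₁(M) → PGL(2, ℂ) = PSL(2, ℂ)` of the structure, lifted to `GL(2, ℂ)`. -/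
def holGL : KnotGroup →* GL (Fin 2) ℂ :=
  PresentedGroup.toGroup (f := ![S.matX, S.matY]) (by
    intro r hr
    rw [Set.mem_singleton_iff] at hr
    subst hr
    rw [map_mul, map_inv, mul_inv_eq_one]
    simpa [fa, fx, fy] using S.mat_rel)

end Shapes

/-! ### The Klein model: `PSL(2, ℂ)` and `SO(3, 1)` -/

/-- The Lorentzian form `x₁² + x₂² + x₃² - x₄²`. -/
def J : Matrix (Fin 4) (Fin 4) ℝ := diagonal ![1, 1, 1, -1]

/-- The group `SO(3, 1)`. -/
def SO31 : Subgroup (GL (Fin 4) ℝ) where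
  carrier := {A | (A : Matrix (Fin 4) (Fin 4) ℝ).det = 1 ∧
    (A : Matrix (Fin 4) (Fin 4) ℝ)ᵀ * J * (A : Matrix (Fin 4) (Fin 4) ℝ) = J}
  one_mem' := by simp
  mul_mem' := by
    rintro A B ⟨hA', hA⟩ ⟨hB', hB⟩
    refine ⟨by rw [Units.val_mul, det_mul, hA', hB', one_mul], ?_⟩
    rw [Units.val_mul, transpose_mul]
    calc _ = (B : Matrix (Fin 4) (Fin 4) ℝ)ᵀ * ((A : Matrix (Fin 4) (Fin 4) ℝ)ᵀ * J *
          (A : Matrix (Fin 4) (Fin 4) ℝ)) * (B : Matrix (Fin 4) (Fin 4) ℝ) := by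
            simp only [Matrix.mul_assoc]
      _ = J := by rw [hA, hB]
  inv_mem' := by
    rintro A ⟨hA', hA⟩
    have h : (A : Matrix (Fin 4) (Fin 4) ℝ) * (A⁻¹ : GL (Fin 4) ℝ).1 = 1 := by
      rw [← Units.val_mul, mul_inv_cancel, Units.val_one]
    have h' : ((A⁻¹ : GL (Fin 4) ℝ).1)ᵀ * (A : Matrix (Fin 4) (Fin 4) ℝ)ᵀ = 1 := by
      rw [← transpose_mul, h, transpose_one]
    refine ⟨by simp [hA'], ?_⟩
    conv_lhs => rw [← hA]
    calc _ = (((A⁻¹ : GL (Fin 4) ℝ).1)ᵀ * (A : Matrix (Fin 4) (Fin 4) ℝ)ᵀ) * J *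
        ((A : Matrix (Fin 4) (Fin 4) ℝ) * (A⁻¹ : GL (Fin 4) ℝ).1) := by
          simp only [Matrix.mul_assoc]
      _ = J := by rw [h, h', Matrix.one_mul, Matrix.mul_one]

/-- The Hermitian matrix with Klein model coordinates `t`. The null vector
`(4 Re s, 4 Im s, 4 - |s|², 4 + |s|²)` of the boundary point `s ∈ ℂ` of the upper half space
corresponds to `(s, 1) (s, 1)ᴴ`, and `det (herm t) = -(t₀² + t₁² + t₂² - t₃²) / 16`. -/
def herm (t : Fin 4 → ℝ) : Matrix (Fin 2) (Fin 2) ℂ :=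
  !![(((t 3 - t 2) / 2 : ℝ) : ℂ), ⟨t 0 / 4, t 1 / 4⟩;
     ⟨t 0 / 4, -(t 1 / 4)⟩, (((t 3 + t 2) / 8 : ℝ) : ℂ)]

/-- The Klein model coordinates of a Hermitian matrix. -/
def coord (K : Matrix (Fin 2) (Fin 2) ℂ) : Fin 4 → ℝ :=
  ![4 * (K 0 1).re, 4 * (K 0 1).im, 4 * (K 1 1).re - (K 0 0).re, 4 * (K 1 1).re + (K 0 0).re]

/-- The matrix of the action `H ↦ g H gᴴ / |det g|` on Hermitian matrices, in the Klein model
coordinates. -/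
def kleinMat (g : GL (Fin 2) ℂ) : Matrix (Fin 4) (Fin 4) ℝ :=
  of fun i j => coord ((g : Matrix (Fin 2) (Fin 2) ℂ) * herm (Pi.single j 1) *
    (g : Matrix (Fin 2) (Fin 2) ℂ)ᴴ) i / ‖(g : Matrix (Fin 2) (Fin 2) ℂ).det‖

lemma norm_det_ne (g : GL (Fin 2) ℂ) : ‖(g : Matrix (Fin 2) (Fin 2) ℂ).det‖ ≠ 0 := by
  rw [norm_ne_zero_iff]
  exact ((isUnit_iff_isUnit_det _).1 g.isUnit).ne_zero

lemma coord_herm (t : Fin 4 → ℝ) : coord (herm t) = t := by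
  ext i
  fin_cases i <;> simp [coord, herm] <;> ring

lemma herm_coord {K : Matrix (Fin 2) (Fin 2) ℂ} (hK : Kᴴ = K) : herm (coord K) = K := by
  have h00 := congrFun (congrFun hK 0) 0
  have h10 := congrFun (congrFun hK 1) 0
  have h11 := congrFun (congrFun hK 1) 1
  simp only [conjTranspose_apply, Complex.ext_iff, Complex.star_def, Complex.conj_re,
    Complex.conj_im] at h00 h10 h11
  ext i j
  fin_cases i <;> fin_cases j <;> simp [coord, herm, Complex.ext_iff] <;>
    (try constructor) <;> linarith

lemma herm_isHermitian (t : Fin 4 → ℝ) : (herm t)ᴴ = herm t := by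
  ext i j
  fin_cases i <;> fin_cases j <;> simp [herm, Complex.ext_iff]

lemma kleinMat_mulVec (g : GL (Fin 2) ℂ) (t : Fin 4 → ℝ) :
    kleinMat g *ᵥ t = (‖(g : Matrix (Fin 2) (Fin 2) ℂ).det‖)⁻¹ •
      coord ((g : Matrix (Fin 2) (Fin 2) ℂ) * herm t * (g : Matrix (Fin 2) (Fin 2) ℂ)ᴴ) := by
  ext i
  fin_cases i <;>
  simp [kleinMat, coord, herm, Matrix.mulVec, dotProduct, Fin.sum_univ_four, Matrix.mul_apply,
    Fin.sum_univ_two, Pi.single_apply] <;> ring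

lemma herm_smul (c : ℝ) (t : Fin 4 → ℝ) : herm (c • t) = (c : ℂ) • herm t := by
  ext i j
  fin_cases i <;> fin_cases j <;> simp [herm, Complex.ext_iff] <;> (try constructor) <;> ring

lemma coord_smul (c : ℝ) (K : Matrix (Fin 2) (Fin 2) ℂ) : coord ((c : ℂ) • K) = c • coord K := by
  ext i
  fin_cases i <;> simp [coord] <;> ring

lemma kleinMat_mul (g h : GL (Fin 2) ℂ) : kleinMat (g * h) = kleinMat g * kleinMat h := by
  apply Matrix.ext_of_mulVec_single
  intro j
  rw [← Matrix.mulVec_mulVec]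
  generalize (Pi.single j 1 : Fin 4 → ℝ) = t
  rw [kleinMat_mulVec, kleinMat_mulVec, kleinMat_mulVec, herm_smul, herm_coord]
  · rw [Matrix.mul_smul, Matrix.smul_mul, coord_smul, smul_smul, Units.val_mul, det_mul, norm_mul,
      mul_inv, conjTranspose_mul]
    simp only [Matrix.mul_assoc]
  · rw [conjTranspose_mul, conjTranspose_mul, conjTranspose_conjTranspose, herm_isHermitian,
      Matrix.mul_assoc]

lemma kleinMat_one : kleinMat 1 = 1 := by
  apply Matrix.ext_of_mulVec_single
  intro j
  rw [kleinMat_mulVec, Matrix.one_mulVec]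
  simp [coord_herm]

lemma kleinMat_lorentz (g : GL (Fin 2) ℂ) : (kleinMat g)ᵀ * J * kleinMat g = J := by
  have hd := norm_det_ne g
  have hn : ‖(g : Matrix (Fin 2) (Fin 2) ℂ).det‖ ^ 2
      = Complex.normSq (g : Matrix (Fin 2) (Fin 2) ℂ).det := (Complex.normSq_eq_norm_sq _).symm
  have key : (kleinMat g)ᵀ * J * kleinMat g = (‖(g : Matrix (Fin 2) (Fin 2) ℂ).det‖ ^ 2)⁻¹ •
      (‖(g : Matrix (Fin 2) (Fin 2) ℂ).det‖ ^ 2 • J) := by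
    rw [hn]
    have hk : kleinMat g = (‖(g : Matrix (Fin 2) (Fin 2) ℂ).det‖)⁻¹ • of fun i j =>
        coord ((g : Matrix (Fin 2) (Fin 2) ℂ) * herm (Pi.single j 1) *
          (g : Matrix (Fin 2) (Fin 2) ℂ)ᴴ) i := by
      ext i j
      simp [kleinMat, div_eq_inv_mul]
    rw [hk, transpose_smul, Matrix.smul_mul, Matrix.smul_mul, Matrix.mul_smul, smul_smul, ← mul_inv,
      ← pow_two, hn]
    congr 1
    generalize (g : Matrix (Fin 2) (Fin 2) ℂ) = m
    ext i j
    fin_cases i <;> fin_cases j <;>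
    simp [Matrix.mul_apply, J, diagonal, coord, herm, Fin.sum_univ_four, Fin.sum_univ_two,
      Pi.single_apply, det_fin_two, Complex.normSq_apply] <;> ring
  rw [key, smul_smul, inv_mul_cancel₀ (pow_ne_zero 2 hd), one_smul]

lemma kleinMat_det_sq (g : GL (Fin 2) ℂ) : (kleinMat g).det * (kleinMat g).det = 1 := by
  have h := congrArg det (kleinMat_lorentz g)
  have hJ : J.det = -1 := by simp [J, Fin.prod_univ_four]
  rw [det_mul, det_mul, det_transpose, hJ] at h
  linarith

lemma kleinMat_det (g : GL (Fin 2) ℂ) : (kleinMat g).det = 1 := by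
  have sq : ∀ h : GL (Fin 2) ℂ, (kleinMat (h * h)).det = 1 := fun h => by
    rw [kleinMat_mul, det_mul, kleinMat_det_sq]
  suffices H : ∀ m : Matrix (Fin 2) (Fin 2) ℂ, m.det ≠ 0 →
      ∀ k : GL (Fin 2) ℂ, k.1 = m → (kleinMat k).det = 1 from
    H g.1 ((isUnit_iff_isUnit_det _).1 g.isUnit).ne_zero g rfl
  intro m hm
  refine diagonal_transvection_induction_of_det_ne_zero
    (fun m => ∀ k : GL (Fin 2) ℂ, k.1 = m → (kleinMat k).det = 1) m hm ?_ ?_ ?_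
  · intro D hD k hk
    have hD' : ∀ i, D i ≠ 0 := by simpa [det_diagonal, Finset.prod_ne_zero_iff] using hD
    choose r hr using fun i => IsAlgClosed.exists_pow_nat_eq (D i) two_pos
    have hr' : (diagonal r).det ≠ 0 := by
      rw [det_diagonal, Finset.prod_ne_zero_iff]
      intro i _ h0
      exact hD' i (by simp [← hr i, h0])
    rw [← sq (GeneralLinearGroup.mkOfDetNeZero _ hr')]
    congr 2
    apply Units.ext
    rw [hk, Units.val_mul]
    change _ = diagonal r * diagonal r
    rw [diagonal_mul_diagonal]
    congr 1
    ext i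
    rw [← hr i, pow_two]
  · intro t k hk
    have ht : (transvection t.i t.j (t.c / 2)).det ≠ 0 := by
      rw [det_transvection_of_ne _ _ t.hij]
      exact one_ne_zero
    rw [← sq (GeneralLinearGroup.mkOfDetNeZero _ ht)]
    congr 2
    apply Units.ext
    rw [hk, Units.val_mul]
    change _ = transvection t.i t.j (t.c / 2) * transvection t.i t.j (t.c / 2)
    rw [transvection_mul_transvection_same _ _ t.hij, add_halves]
    rfl
  · intro A B hA hB iA iB k hk
    have : k = GeneralLinearGroup.mkOfDetNeZero A hA * GeneralLinearGroup.mkOfDetNeZero B hB :=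
      Units.ext hk
    rw [this, kleinMat_mul, det_mul, iA _ rfl, iB _ rfl, one_mul]

/-- The isomorphism of `PSL(2, ℂ) = PGL(2, ℂ)` with the identity component of `SO(3, 1)`, as a
homomorphism on `GL(2, ℂ)`. -/
def klein : GL (Fin 2) ℂ →* SO31 where
  toFun g := ⟨GeneralLinearGroup.mkOfDetNeZero (kleinMat g) (by simp [kleinMat_det]),
    kleinMat_det g, kleinMat_lorentz g⟩
  map_one' := Subtype.ext (Units.ext kleinMat_one)
  map_mul' g h := Subtype.ext (Units.ext (kleinMat_mul g h))

/-- The holonomy `ρ_u : π₁(M) → SO(3, 1)` of the structure. -/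
def Shapes.hol (S : Shapes) : KnotGroup →* SO31 := klein.comp S.holGL

/-! ### The modules `𝔰𝔩(4, ℝ)` and `𝔳` -/

/-- The trace-free matrices `𝔰𝔩(4, ℝ)`. -/
def sl4 : Submodule ℝ (Matrix (Fin 4) (Fin 4) ℝ) := LinearMap.ker (traceLinearMap (Fin 4) ℝ ℝ)

/-- The Lie algebra `𝔰𝔬(3, 1)`. -/
def so31 : Submodule ℝ (Matrix (Fin 4) (Fin 4) ℝ) where
  carrier := {A | A.trace = 0 ∧ Aᵀ * J = -(J * A)}
  add_mem' := by
    rintro A B ⟨hA', hA⟩ ⟨hB', hB⟩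
    exact ⟨by rw [trace_add, hA', hB', add_zero],
      by rw [transpose_add, Matrix.add_mul, Matrix.mul_add, hA, hB, neg_add]⟩
  zero_mem' := by simp
  smul_mem' := by
    rintro c A ⟨hA', hA⟩
    exact ⟨by rw [trace_smul, hA', smul_zero],
      by rw [transpose_smul, Matrix.smul_mul, Matrix.mul_smul, hA, smul_neg]⟩

/-- The Killing form of `𝔰𝔩(4, ℝ)`, `B(A, B) = 8 tr (A B)`. -/
def killing (A B : Matrix (Fin 4) (Fin 4) ℝ) : ℝ := 8 * (A * B).trace

/-- The orthogonal complement `𝔳` of `𝔰𝔬(3, 1)` in `𝔰𝔩(4, ℝ)` for the Killing form. -/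
def 𝔳 : Submodule ℝ (Matrix (Fin 4) (Fin 4) ℝ) where
  carrier := {A | A ∈ sl4 ∧ ∀ B ∈ so31, killing A B = 0}
  add_mem' := by
    rintro A B ⟨hA', hA⟩ ⟨hB', hB⟩
    refine ⟨add_mem hA' hB', fun C hC => ?_⟩
    have h1 := hA C hC
    have h2 := hB C hC
    rw [killing] at *
    rw [Matrix.add_mul, trace_add, mul_add, h1, h2, add_zero]
  zero_mem' := ⟨zero_mem _, fun C _ => by simp [killing]⟩
  smul_mem' := by
    rintro c A ⟨hA', hA⟩
    refine ⟨Submodule.smul_mem _ _ hA', fun C hC => ?_⟩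
    have h1 := hA C hC
    rw [killing] at *
    rw [Matrix.smul_mul, trace_smul, mul_smul_comm, h1, smul_zero]

/-- The conjugation action `A ↦ g A g⁻¹` of `SO(3, 1)` on matrices. -/
def conj : Representation ℝ SO31 (Matrix (Fin 4) (Fin 4) ℝ) where
  toFun g :=
    { toFun := fun A => g.1.1 * A * (g.1⁻¹).1
      map_add' := fun A B => by simp [Matrix.mul_add, Matrix.add_mul]
      map_smul' := fun c A => by simp }
  map_one' := by
    ext1 A
    simp
  map_mul' g h := by
    ext1 A
    simp [Matrix.mul_assoc]

lemma conj_mem_sl4 (g : SO31) {A : Matrix (Fin 4) (Fin 4) ℝ} (hA : A ∈ sl4) :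
    conj g A ∈ sl4 := by
  have hA : A.trace = 0 := hA
  change (g.1.1 * A * (g.1⁻¹).1).trace = 0
  rw [trace_mul_comm, ← Matrix.mul_assoc, ← Units.val_mul, inv_mul_cancel, Units.val_one,
    Matrix.one_mul, hA]

lemma conj_mem_so31 (g : SO31) {A : Matrix (Fin 4) (Fin 4) ℝ} (hA : A ∈ so31) :
    conj g A ∈ so31 := by
  refine ⟨conj_mem_sl4 g hA.1, ?_⟩
  have hA : Aᵀ * J = -(J * A) := hA.2
  have hg : g.1.1ᵀ * J * g.1.1 = J := g.2.2
  have hi : (g⁻¹).1.1ᵀ * J * (g⁻¹).1.1 = J := (g⁻¹).2.2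
  have h1 : g.1.1 * (g⁻¹).1.1 = 1 := by
    rw [Subgroup.coe_inv, ← Units.val_mul, mul_inv_cancel, Units.val_one]
  have h2 : (g⁻¹).1.1ᵀ * J = J * g.1.1 := by
    calc _ = (g⁻¹).1.1ᵀ * J * ((g⁻¹).1.1 * g.1.1) := by
          rw [mul_eq_one_comm.1 h1, Matrix.mul_one]
      _ = J * g.1.1 := by rw [← Matrix.mul_assoc, hi]
  have h3 : g.1.1ᵀ * J = J * (g⁻¹).1.1 := by
    calc _ = g.1.1ᵀ * J * (g.1.1 * (g⁻¹).1.1) := by rw [h1, Matrix.mul_one]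
      _ = J * (g⁻¹).1.1 := by rw [← Matrix.mul_assoc, hg]
  change (g.1.1 * A * (g⁻¹).1.1)ᵀ * J = -(J * (g.1.1 * A * (g⁻¹).1.1))
  calc _ = (g⁻¹).1.1ᵀ * (Aᵀ * (g.1.1ᵀ * J)) := by
        simp only [transpose_mul, Matrix.mul_assoc]
    _ = (g⁻¹).1.1ᵀ * (Aᵀ * J) * (g⁻¹).1.1 := by rw [h3]; simp only [Matrix.mul_assoc]
    _ = -(((g⁻¹).1.1ᵀ * J) * (A * (g⁻¹).1.1)) := by
        rw [hA]; simp only [Matrix.mul_assoc, Matrix.mul_neg, Matrix.neg_mul]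
    _ = _ := by rw [h2]; simp only [Matrix.mul_assoc]

lemma conj_mem_𝔳 (g : SO31) {A : Matrix (Fin 4) (Fin 4) ℝ} (hA : A ∈ 𝔳) : conj g A ∈ 𝔳 := by
  refine ⟨conj_mem_sl4 g hA.1, fun B hB => ?_⟩
  rw [← hA.2 _ (conj_mem_so31 g⁻¹ hB)]
  have : conj g⁻¹ B = (g.1⁻¹).1 * B * g.1.1 := by
    change (g⁻¹).1.1 * B * ((g⁻¹).1⁻¹).1 = _
    simp
  rw [killing, killing, this]
  change 8 * ((g.1.1 * A * (g.1⁻¹).1) * B).trace = _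
  congr 1
  rw [← Matrix.mul_assoc, ← Matrix.mul_assoc, trace_mul_comm _ g.1.1]
  simp only [Matrix.mul_assoc]

/-- The adjoint action of `SO(3, 1)` on `𝔰𝔩(4, ℝ)`. -/
def Ad : Representation ℝ SO31 sl4 := conj.subrepresentation sl4 fun g _ hA => conj_mem_sl4 g hA

/-- The adjoint action of `SO(3, 1)` on `𝔳`. -/
def AdV : Representation ℝ SO31 𝔳 := conj.subrepresentation 𝔳 fun g _ hA => conj_mem_𝔳 g hA

/-! ### Twisted cohomology, restrictions to the boundary curves, the slope -/

open groupCohomology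

/-- The module `𝔳` twisted by a homomorphism to `SO(3, 1)`. -/
abbrev twistedV {G : Type} [Group G] (σ : G →* SO31) : Rep ℝ G := Rep.of (X := 𝔳) (AdV.comp σ)

/-- The module `𝔰𝔩(4, ℝ)` twisted by a homomorphism to `SO(3, 1)`. -/
abbrev twistedSl4 {G : Type} [Group G] (σ : G →* SO31) : Rep ℝ G := Rep.of (X := sl4) (Ad.comp σ)

/-- Infinitesimal projective rigidity of a closed hyperbolic manifold with fundamental group `G`
and holonomy `σ`: `H¹(G; 𝔰𝔩(4, ℝ)_{Ad σ}) = 0`. -/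
def InfinitesimallyProjectivelyRigid {G : Type} [Group G] (σ : G →* SO31) : Prop :=
  Subsingleton (H1 (twistedSl4 σ))

namespace Shapes

variable (S : Shapes)

/-- The `π₁(M)`-module `𝔳_u`. -/
abbrev 𝔳u : Rep ℝ KnotGroup := twistedV S.hol

/-- The restriction `H¹(M; 𝔳_u) → H¹(g; 𝔳_u)` to the circle `ℤ → π₁(M)`, `n ↦ g ^ n`. -/
def resCircle (g : KnotGroup) :
    H1 S.𝔳u ⟶ H1 (Rep.res (zpowersHom KnotGroup g) S.𝔳u) :=
  groupCohomology.map (zpowersHom KnotGroup g) (CategoryTheory.CategoryStruct.id _) 1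

/-- The endomorphism `1 - g` of `𝔳_u`. -/
def oneSub (g : KnotGroup) : 𝔳 →ₗ[ℝ] 𝔳 := (LinearMap.id : 𝔳 →ₗ[ℝ] 𝔳) - AdV (S.hol g)

/-- The invariants `H⁰(g; 𝔳_u) = 𝔳_u^g = ker (1 - g)`. -/
def fixedBy (g : KnotGroup) : Submodule ℝ 𝔳 := LinearMap.ker (S.oneSub g)

/-- The image of `1 - g` on `𝔳_u`; `H¹(g; 𝔳_u)` is the quotient of `𝔳_u` by it, a cocycle `z`
being sent to the class of `z g`. -/
def imageOf (g : KnotGroup) : Submodule ℝ 𝔳 := LinearMap.range (S.oneSub g)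

/-- `s = c₁ / c₂`, where `a` is a basis of `𝔳_u^x = 𝔳_u^l`, `z` represents a nonzero class in
`H¹(M; 𝔳_u)`, and `c₁ a` and `c₂ a` are the components of `z x` and `z l` in the first summand of
`𝔳_u = ker (1 - x) ⊕ im (1 - x)` and of `𝔳_u = ker (1 - l) ⊕ im (1 - l)`. -/
def IsSlope (s : ℝ) : Prop :=
  ∃ (a : 𝔳) (z : cocycles₁ S.𝔳u) (c₁ c₂ : ℝ),
    a ≠ 0 ∧ S.fixedBy x = Submodule.span ℝ {a} ∧ S.fixedBy l = Submodule.span ℝ {a} ∧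
    H1π S.𝔳u z ≠ 0 ∧
    (z x : 𝔳) - c₁ • a ∈ S.imageOf x ∧ (z l : 𝔳) - c₂ • a ∈ S.imageOf l ∧
    s = c₁ / c₂

/-- The slope `s_u` of the representation. -/
def slope : ℝ := Classical.epsilon S.IsSlope

end Shapes

end FigEight

end

noncomputable section

namespace FigEight

/-! ### Representations of the knot group on `2 × 2` matrices in normal form -/

/-! The adjoint `J Aᵀ J` commutes with conjugation by `SO(3, 1)`, so `𝔰𝔩(4, ℝ)` splits equivariantly
into its `-1` eigenspace `𝔰𝔬(3, 1)` and trace-free `+1` eigenspace, which lies in `𝔳`. A crossed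
homomorphism on the filled group is one on the knot group that vanishes on `x ^ p l ^ q`. It
suffices to show that both components of such a map are principal.

In `𝔳`, the half turn about the axis of the boundary torus is itself a matrix in `𝔳`, fixed by `x`
and `l`. The trace form against it is an invariant functional `P`, and by a dimension count its
kernel is `im (1 - x) = im (1 - l)` (`mem_imageOf_iff`). Hence the slope is `P (z x) / P (z l)`,
independently of choices (`isSlope_iff`). Invariance of `P` gives `P (z (x ^ p l ^ q)) = p P (z x) +
q P (z l)`. If `z` has nonzero class and vanishes on the filling curve, this forces slope `-q / p`
when `p ≠ 0`, and is contradictory when `p = 0` (`H1π_eq_zero_of_filling`).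

In `𝔰𝔬(3, 1) ≅ 𝔰𝔩(2, ℂ)`, a crossed homomorphism is a deformation of the holonomy over the dual
numbers. After subtracting a coboundary it stays in the triangular normal form, hence is a tangent
vector to the curve of shapes, and vanishing on the filling curve says `p du + q dv = 0` on it. The
Neumann–Zagier positivity `shapes_tangent_eq_zero` then makes it zero (`crossedHom_sl2_principal`).

The holonomy descends because `exp (p u + q v) = 1` equates the eigenvalues of `x ^ p l ^ q`
(`hol_filling_eq_one`). The coefficient equation also excludes the complete structure, where `u = v
= 0`, so `w ≠ 1` throughout. -/

lemma a_mul_x : a * x = y * a := by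
  have h : PresentedGroup.mk ({fa * fx * (fy * fa)⁻¹} : Set (FreeGroup (Fin 2)))
      (fa * fx * (fy * fa)⁻¹) = 1 := PresentedGroup.one_of_mem rfl
  rw [map_mul, map_inv, mul_inv_eq_one] at h
  exact h

lemma l_eq : l = y * x⁻¹ * y⁻¹ * x * x * y⁻¹ * x⁻¹ * y := by
  simp only [l, a, b]
  group

/-- A homomorphism of the knot group to `2 × 2` matrices over a commutative ring which sends the
two Wirtinger generators to multiples of triangular matrices with parameters `W` and `Z`. -/
structure IsNormalForm {R : Type*} [CommRing R] (F : KnotGroup →* Matrix (Fin 2) (Fin 2) R)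
    (c W : Rˣ) (Z : R) : Prop where
  map_x : F x = (c : R) • !![1, -1; 0, (W : R)]
  map_y : F y = (c : R) • !![(W : R), 0; -Z, 1]

namespace IsNormalForm

variable {R : Type*} [CommRing R] {F : KnotGroup →* Matrix (Fin 2) (Fin 2) R} {c W : Rˣ} {Z : R}

lemma map_x_inv (h : IsNormalForm F c W Z) :
    F x⁻¹ = ((c⁻¹ * W⁻¹ : Rˣ) : R) • !![(W : R), 1; 0, 1] := by
  have h1 : F x⁻¹ * F x = 1 := by rw [← map_mul, inv_mul_cancel, map_one]
  refine left_inv_eq_right_inv h1 ?_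
  rw [h.map_x, Matrix.smul_mul, Matrix.mul_smul, smul_smul, ← Units.val_mul, mul_inv_cancel_left]
  ext i j
  fin_cases i <;> fin_cases j <;> simp

lemma map_y_inv (h : IsNormalForm F c W Z) :
    F y⁻¹ = ((c⁻¹ * W⁻¹ : Rˣ) : R) • !![1, 0; Z, (W : R)] := by
  have h1 : F y⁻¹ * F y = 1 := by rw [← map_mul, inv_mul_cancel, map_one]
  refine left_inv_eq_right_inv h1 ?_
  rw [h.map_y, Matrix.smul_mul, Matrix.mul_smul, smul_smul, ← Units.val_mul, mul_inv_cancel_left]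
  ext i j
  fin_cases i <;> fin_cases j <;> simp [mul_comm]

/-- The equation of the curve of representations. -/
lemma curve (h : IsNormalForm F c W Z) :
    Z ^ 2 - ((W : R) ^ 2 - W + 1) * Z + (W : R) ^ 2 = 0 := by
  have h1 := congrArg F a_mul_x
  simp only [a, map_mul, h.map_x_inv, h.map_y_inv, h.map_x, h.map_y, Matrix.smul_mul,
    Matrix.mul_smul, smul_smul, ← Units.val_mul] at h1
  have h2 : (c * W⁻¹ ^ 2) • (!![1, -1; 0, (W : R)] * !![1, 0; Z, (W : R)] *
      !![(W : R), 1; 0, 1] * !![(W : R), 0; -Z, 1] * !![1, -1; 0, (W : R)]) =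
      (c * W⁻¹ ^ 2) • (!![(W : R), 0; -Z, 1] * (!![1, -1; 0, (W : R)] *
      !![1, 0; Z, (W : R)] * !![(W : R), 1; 0, 1] * !![(W : R), 0; -Z, 1])) := by
    rw [Units.smul_def, Units.smul_def]
    convert h1 using 3 <;>
    -- The scalar factors agree as units; in additive notation this is an identity in a commutative
    -- group.
    · apply Additive.ofMul.injective
      simp only [ofMul_mul, ofMul_inv, ofMul_pow]
      abel
  have h3 := congrFun (congrFun (smul_left_cancel _ h2) 0) 1
  simp [Matrix.mul_apply, Fin.sum_univ_two] at h3
  linear_combination -h3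

/-- The image of the longitude. -/
lemma map_l (h : IsNormalForm F c W Z) :
    (W : R) ^ 4 • F l = !![(W : R), 0; -Z, 1] * !![(W : R), 1; 0, 1] *
      !![1, 0; Z, (W : R)] * !![1, -1; 0, (W : R)] * !![1, -1; 0, (W : R)] *
      !![1, 0; Z, (W : R)] * !![(W : R), 1; 0, 1] * !![(W : R), 0; -Z, 1] := by
  simp only [l_eq, map_mul, h.map_x_inv, h.map_y_inv, h.map_x, h.map_y, Matrix.smul_mul,
    Matrix.mul_smul, smul_smul, ← Units.val_mul, ← Units.val_pow_eq_pow_val]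
  -- The word for `l` has exponent sum zero, so `c` cancels, and its four inverse letters contribute
  -- `W⁻⁴`.
  convert one_smul R _ using 2
  rw [← Units.val_one]
  congr 1
  apply Additive.ofMul.injective
  simp only [ofMul_mul, ofMul_inv, ofMul_pow, ofMul_one]
  abel

/-- The longitude commutes with the triangular meridian. This and the next three entry identities
hold modulo the polynomial of `curve`, with an explicit cofactor. They avoid dividing by `Z` or `1 -
Z`, and the general ring allows both `ℂ` and the dual numbers. -/
lemma map_l_one_zero (h : IsNormalForm F c W Z) : F l 1 0 = 0 := by
  have h1 := congrFun (congrFun h.map_l 1) 0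
  simp [Matrix.mul_apply, Fin.sum_univ_two] at h1
  refine (W ^ 4).isUnit.mul_right_eq_zero.1 ?_
  rw [Units.val_pow_eq_pow_val]
  linear_combination h1 + (Z - Z ^ 2 - W * Z - W * Z ^ 2 - W ^ 2 * Z + W ^ 3 * Z) * h.curve

lemma map_l_one_one (h : IsNormalForm F c W Z) : Z * F l 1 1 = (1 - Z) ^ 2 := by
  have h1 := congrFun (congrFun h.map_l 1) 1
  simp [Matrix.mul_apply, Fin.sum_univ_two] at h1
  refine (W ^ 4).isUnit.mul_right_injective ?_
  simp only [Units.val_pow_eq_pow_val]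
  linear_combination Z * h1 + (-Z + Z ^ 2 + W * Z + W * Z ^ 2 - W ^ 2 + 2 * W ^ 2 * Z) * h.curve

lemma map_l_zero_zero (h : IsNormalForm F c W Z) : (1 - Z) ^ 2 * F l 0 0 = Z := by
  have h1 := congrFun (congrFun h.map_l 0) 0
  simp [Matrix.mul_apply, Fin.sum_univ_two] at h1
  refine (W ^ 4).isUnit.mul_right_injective ?_
  simp only [Units.val_pow_eq_pow_val]
  linear_combination (1 - Z) ^ 2 * h1 + (W * Z - 2 * W * Z ^ 2 + W * Z ^ 3 + W ^ 2
    - 2 * W ^ 2 * Z + W ^ 2 * Z ^ 3 - 2 * W ^ 3 * Z + W ^ 3 * Z ^ 2 + W ^ 4 * Z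
    - W ^ 4 * Z ^ 2) * h.curve

lemma map_l_zero_one (h : IsNormalForm F c W Z) :
    (1 - (W : R)) * F l 0 1 = F l 1 1 - F l 0 0 := by
  have h00 := congrFun (congrFun h.map_l 0) 0
  have h01 := congrFun (congrFun h.map_l 0) 1
  have h11 := congrFun (congrFun h.map_l 1) 1
  simp [Matrix.mul_apply, Fin.sum_univ_two] at h00 h01 h11
  refine (W ^ 4).isUnit.mul_right_injective ?_
  simp only [Units.val_pow_eq_pow_val]
  linear_combination h00 - h11 + (1 - (W : R)) * h01 +
    (1 - Z - 2 * W + W ^ 2 * Z + 2 * W ^ 3 - W ^ 4) * h.curve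

end IsNormalForm

/-! ### Crossed homomorphisms -/

section Crossed

variable {k G V U : Type*} [CommRing k] [Group G] [AddCommGroup V] [Module k V] [AddCommGroup U]
  [Module k U]

/-- A linear map which is invariant under two elements turns a crossed homomorphism into a
homomorphism on the subgroup which they generate. -/
lemma invariant_crossedHom_zpow_mul_zpow (ρ : Representation k G V) {f : G → V}
    (hf : ∀ g h, f (g * h) = ρ g (f h) + f g) (P : V →ₗ[k] U) {g h : G}
    (hg : ∀ v, P (ρ g v) = P v) (hh : ∀ v, P (ρ h v) = P v) (p q : ℤ) :
    P (f (g ^ p * h ^ q)) = p • P (f g) + q • P (f h) := by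
  let K : Subgroup G :=
    { carrier := {g | ∀ v, P (ρ g v) = P v}
      one_mem' := by simp
      mul_mem' := by
        intro r s hr hs v
        rw [map_mul, Module.End.mul_apply, hr, hs]
      inv_mem' := by
        intro r hr v
        rw [← hr, ← Module.End.mul_apply, ← map_mul, mul_inv_cancel, map_one,
          Module.End.one_apply] }
  let φ : K →* Multiplicative U := MonoidHom.mk' (fun r => Multiplicative.ofAdd (P (f r))) (by
    intro r s
    rw [Subgroup.coe_mul, hf, map_add, r.2, ← ofAdd_add, add_comm])
  have h1 := map_mul φ ((⟨g, hg⟩ : K) ^ p) ((⟨h, hh⟩ : K) ^ q)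
  rw [map_zpow, map_zpow] at h1
  exact congrArg Multiplicative.toAdd h1

/-- A crossed homomorphism on `ℤ` with given value at the generator. -/
lemma exists_crossedHom_int (ρ : Representation k (Multiplicative ℤ) V) (v : V) :
    ∃ f : Multiplicative ℤ → V, (∀ g h, f (g * h) = ρ g (f h) + f g) ∧
      f (Multiplicative.ofAdd 1) = v := by
  let e : V ≃ₗ[k] V :=
    LinearMap.GeneralLinearGroup.generalLinearEquiv k V (ρ.asGroupHom (Multiplicative.ofAdd 1))
  -- A crossed homomorphism is the translation part of an affine action: `T` has linear part `ρ 1`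
  -- and sends `0` to `v`, so `n ↦ T ^ n 0` is the required map.
  let T : V ≃ᵃ[k] V := e.toAffineEquiv.trans (AffineEquiv.constVAdd k V v)
  have hT : ∀ n : ℤ, (AffineEquiv.linearHom (T ^ n) : V ≃ₗ[k] V).toLinearMap =
      ρ (Multiplicative.ofAdd n) := by
    have h : AffineEquiv.linearHom.comp (zpowersHom (V ≃ᵃ[k] V) T) =
        (LinearMap.GeneralLinearGroup.generalLinearEquiv k V).toMonoidHom.comp ρ.asGroupHom := by
      apply MonoidHom.ext_mint
      ext v
      simp only [MonoidHom.comp_apply, zpowersHom_apply, toAdd_ofAdd, zpow_one]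
      rfl
    intro n
    have h1 := DFunLike.congr_fun h (Multiplicative.ofAdd n)
    simp only [MonoidHom.comp_apply, zpowersHom_apply, toAdd_ofAdd] at h1
    rw [h1]
    exact ρ.asGroupHom_apply _
  refine ⟨fun n => (T ^ (Multiplicative.toAdd n)) 0, fun g h => ?_, ?_⟩
  · change (T ^ (Multiplicative.toAdd g + Multiplicative.toAdd h)) 0 = _
    have h1 := (T ^ Multiplicative.toAdd g).map_vadd 0 ((T ^ Multiplicative.toAdd h) 0)
    have h2 := LinearMap.congr_fun (hT (Multiplicative.toAdd g))
      ((T ^ Multiplicative.toAdd h) (0 : V))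
    rw [_root_.zpow_add]
    change (T ^ Multiplicative.toAdd g) ((T ^ Multiplicative.toAdd h) 0) = _
    simp only [vadd_eq_add, add_zero] at h1
    rw [h1]
    congr 1
  · simp [T]

/-- A crossed homomorphism vanishes if it does so on generators. -/
lemma crossedHom_eq_zero_of_closure (ρ : Representation k G V) {f : G → V}
    (hf : ∀ g h, f (g * h) = ρ g (f h) + f g) {s : Set G} (hs : Subgroup.closure s = ⊤)
    (h : ∀ g ∈ s, f g = 0) (g : G) : f g = 0 := by
  have h1 : f 1 = 0 := by simpa using hf 1 1
  have hg : g ∈ Subgroup.closure s := hs ▸ Subgroup.mem_top g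
  induction hg using Subgroup.closure_induction with
  | mem g hg => exact h g hg
  | one => exact h1
  | mul r t _ _ hr ht => rw [hf, hr, ht, map_zero, add_zero]
  | inv r _ hr =>
    have h2 := hf r⁻¹ r
    rw [inv_mul_cancel, hr, map_zero, zero_add, h1] at h2
    exact h2.symm

end Crossed

/-! ### The cohomology of a circle -/

section Circle

open groupCohomology

lemma cocycles₁_map_mul {G : Type} [Group G] {A : Rep ℝ G} (f : cocycles₁ A) (g h : G) :
    f (g * h) = A.ρ g (f h) + f g := (mem_cocycles₁_iff (f : G → A)).1 f.2 g h

lemma H1π_eq_zero_iff_exists {G : Type} [Group G] {A : Rep ℝ G} (f : cocycles₁ A) :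
    H1π A f = 0 ↔ ∃ v : A, ∀ g, f g = A.ρ g v - v := by
  rw [H1π_eq_zero_iff]
  constructor
  · rintro ⟨v, hv⟩
    exact ⟨v, fun g => (congrFun hv g).symm⟩
  · rintro ⟨v, hv⟩
    exact ⟨v, funext fun g => (hv g).symm⟩

lemma closure_ofAdd_one : Subgroup.closure {Multiplicative.ofAdd (1 : ℤ)} = ⊤ := by
  rw [← Subgroup.zpowers_eq_closure, eq_top_iff]
  intro n _
  exact ⟨Multiplicative.toAdd n, by simp [← ofAdd_zsmul]⟩

variable (A : Rep.{0} ℝ (Multiplicative ℤ))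

/-- Evaluation of crossed homomorphisms on `ℤ` at the generator. -/
def evalGenerator : cocycles₁ A ≃ₗ[ℝ] A :=
  LinearEquiv.ofBijective
    ((LinearMap.proj (Multiplicative.ofAdd 1) : (Multiplicative ℤ → A) →ₗ[ℝ] A).comp
      (cocycles₁ A).subtype) (by
    constructor
    · rw [← LinearMap.ker_eq_bot, LinearMap.ker_eq_bot']
      intro f hf
      apply cocycles₁_ext
      refine crossedHom_eq_zero_of_closure A.ρ (cocycles₁_map_mul f) closure_ofAdd_one ?_
      rintro _ rfl
      exact hf
    · intro v
      obtain ⟨f, hf, hv⟩ := exists_crossedHom_int A.ρ v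
      exact ⟨⟨f, (mem_cocycles₁_iff f).2 hf⟩, hv⟩)

lemma evalGenerator_apply (f : cocycles₁ A) :
    evalGenerator A f = f (Multiplicative.ofAdd 1) := rfl

lemma H1π_int_eq_zero_iff (f : cocycles₁ A) : H1π A f = 0 ↔
    f (Multiplicative.ofAdd 1) ∈
      LinearMap.range (LinearMap.id - A.ρ (Multiplicative.ofAdd 1)) := by
  rw [H1π_eq_zero_iff_exists]
  constructor
  · rintro ⟨v, hv⟩
    -- The sign converts the coboundary `g v - v` into a value of `1 - g`.
    exact ⟨-v, by simp [hv, neg_add_eq_sub]⟩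
  · rintro ⟨v, hv⟩
    refine ⟨-v, fun g => ?_⟩
    have hc : (fun g => A.ρ g (-v) - (-v)) ∈ cocycles₁ A :=
      (mem_cocycles₁_iff _).2 fun g h => by simp
    have : f = ⟨_, hc⟩ := (evalGenerator A).injective (by
      rw [evalGenerator_apply, evalGenerator_apply, ← hv]
      change _ = A.ρ (Multiplicative.ofAdd 1) (-v) - (-v)
      simp [add_comm, sub_eq_add_neg])
    rw [this]
    rfl

/-- Evaluation at the generator identifies `H¹` with the cokernel of `1 - g`, which for an
endomorphism of a finite-dimensional space has the dimension of the kernel. -/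
lemma finrank_H1_int [Module.Finite ℝ A] : Module.finrank ℝ (H1 A) =
    Module.finrank ℝ (LinearMap.ker (LinearMap.id - A.ρ (Multiplicative.ofAdd 1))) := by
  let φ : A →ₗ[ℝ] H1 A := (H1π A).hom.comp (evalGenerator A).symm.toLinearMap
  have hφ : LinearMap.ker φ =
      LinearMap.range (LinearMap.id - A.ρ (Multiplicative.ofAdd 1)) := by
    ext v
    obtain ⟨f, rfl⟩ := (evalGenerator A).surjective v
    rw [LinearMap.mem_ker]
    change H1π A ((evalGenerator A).symm (evalGenerator A f)) = 0 ↔ _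
    rw [LinearEquiv.symm_apply_apply, H1π_int_eq_zero_iff]
    rfl
  have hs : Function.Surjective φ := by
    intro c
    induction c using H1_induction_on with
    | _ f => exact ⟨evalGenerator A f, congrArg (H1π A) (LinearEquiv.symm_apply_apply _ f)⟩
  have h1 := LinearMap.finrank_range_add_finrank_ker φ
  have h2 := LinearMap.finrank_range_add_finrank_ker
    (LinearMap.id - A.ρ (Multiplicative.ofAdd 1))
  rw [LinearMap.range_eq_top.2 hs, finrank_top, hφ] at h1
  omega

end Circle

/-! ### Restriction of `H¹(M; 𝔳_u)` to the boundary circles -/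

namespace Shapes

open groupCohomology

variable (S : Shapes)

lemma resCircle_eq_zero_iff (g : KnotGroup) (f : cocycles₁ S.𝔳u) :
    S.resCircle g (H1π S.𝔳u f) = 0 ↔ (f g : 𝔳) ∈ S.imageOf g := by
  rw [resCircle, H1π_comp_map_apply, H1π_int_eq_zero_iff]
  have h1 : zpowersHom KnotGroup g (Multiplicative.ofAdd 1) = g := by simp
  have h2 : (mapCocycles₁ (zpowersHom KnotGroup g)
      (CategoryTheory.CategoryStruct.id (Rep.res (zpowersHom KnotGroup g) S.𝔳u))) f
      (Multiplicative.ofAdd 1) = f (zpowersHom KnotGroup g (Multiplicative.ofAdd 1)) := rfl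
  rw [h2, h1]
  have h3 : (Rep.res (zpowersHom KnotGroup g) S.𝔳u).ρ (Multiplicative.ofAdd 1) =
      S.𝔳u.ρ g := by
    change S.𝔳u.ρ (zpowersHom KnotGroup g (Multiplicative.ofAdd 1)) = _
    rw [h1]
  rw [h3]
  rfl

/-- The dimension of the invariants is that of `H¹(g; 𝔳_u)`, which the restriction isomorphism
equates with `dim H¹(M; 𝔳_u)`. -/
lemma finrank_fixedBy {g : KnotGroup} (hdim : Module.finrank ℝ (H1 S.𝔳u) = 1)
    (hg : Function.Bijective (S.resCircle g)) : Module.finrank ℝ (S.fixedBy g) = 1 := by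
  have h1 : zpowersHom KnotGroup g (Multiplicative.ofAdd 1) = g := by simp
  rw [← hdim, (LinearEquiv.ofBijective (S.resCircle g).hom hg).finrank_eq]
  have : Module.Finite ℝ (Rep.res (zpowersHom KnotGroup g) S.𝔳u) :=
    inferInstanceAs (Module.Finite ℝ 𝔳)
  rw [finrank_H1_int]
  have h3 : (Rep.res (zpowersHom KnotGroup g) S.𝔳u).ρ (Multiplicative.ofAdd 1) =
      S.𝔳u.ρ g := by
    change S.𝔳u.ρ (zpowersHom KnotGroup g (Multiplicative.ofAdd 1)) = _
    rw [h1]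
  rw [h3]
  rfl

end Shapes

/-! ### The Klein model and the isomorphism of `𝔰𝔩(2, ℂ)` with `𝔰𝔬(3, 1)` -/

lemma kleinMat_eq_one_of_scalar {g : GL (Fin 2) ℂ} {μ : ℂ}
    (hg : (g : Matrix (Fin 2) (Fin 2) ℂ) = μ • (1 : Matrix (Fin 2) (Fin 2) ℂ)) :
    kleinMat g = 1 := by
  have hd := norm_det_ne g
  have hn : ‖(g : Matrix (Fin 2) (Fin 2) ℂ).det‖ = Complex.normSq μ := by
    rw [hg, det_smul, det_one, mul_one, Fintype.card_fin, norm_pow, Complex.normSq_eq_norm_sq]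
  apply Matrix.ext_of_mulVec_single
  intro j
  generalize (Pi.single j 1 : Fin 4 → ℝ) = t
  rw [kleinMat_mulVec, Matrix.one_mulVec, hn, hg, conjTranspose_smul, Matrix.smul_mul,
    Matrix.mul_smul, Matrix.one_mul, conjTranspose_one, Matrix.mul_one, smul_smul,
    Complex.star_def, mul_comm _ μ, Complex.mul_conj, coord_smul, coord_herm, smul_smul,
    inv_mul_cancel₀ (hn ▸ hd), one_smul]

/-- Over `ℂ` the Hermitian action is the tensor product of the standard representation with its
conjugate. The formula makes the half turn about an axis trace-free. -/
lemma kleinMat_trace (g : GL (Fin 2) ℂ) : (kleinMat g).trace =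
    Complex.normSq (g : Matrix (Fin 2) (Fin 2) ℂ).trace /
      ‖(g : Matrix (Fin 2) (Fin 2) ℂ).det‖ := by
  simp [Matrix.trace, Fin.sum_univ_four, Fin.sum_univ_two, kleinMat, coord, herm,
    Matrix.mul_apply, Pi.single_apply, Complex.normSq_apply]
  ring

/-- The action `H ↦ A H + H Aᴴ` of `𝔰𝔩(2, ℂ)` on Hermitian matrices, in the Klein model
coordinates. -/
def kleinLie (A : Matrix (Fin 2) (Fin 2) ℂ) : Matrix (Fin 4) (Fin 4) ℝ :=
  of fun i j => coord (A * herm (Pi.single j 1) + herm (Pi.single j 1) * Aᴴ) i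

lemma kleinLie_mulVec (A : Matrix (Fin 2) (Fin 2) ℂ) (t : Fin 4 → ℝ) :
    kleinLie A *ᵥ t = coord (A * herm t + herm t * Aᴴ) := by
  ext i
  fin_cases i <;>
  simp [kleinLie, coord, herm, Matrix.mulVec, dotProduct, Fin.sum_univ_four, Matrix.mul_apply,
    Fin.sum_univ_two, Pi.single_apply, vecMul] <;> ring

lemma kleinLie_sub (A B : Matrix (Fin 2) (Fin 2) ℂ) :
    kleinLie (A - B) = kleinLie A - kleinLie B := by
  ext i j
  simp only [kleinLie, of_apply, Matrix.sub_apply]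
  generalize (Pi.single j 1 : Fin 4 → ℝ) = t
  fin_cases i <;> simp [coord, Matrix.mul_apply, Fin.sum_univ_two] <;> ring

lemma kleinLie_conj (g : GL (Fin 2) ℂ) (A : Matrix (Fin 2) (Fin 2) ℂ) :
    kleinLie (g.1 * A * (g⁻¹).1) = kleinMat g * kleinLie A * kleinMat g⁻¹ := by
  have hi : (g⁻¹).1 * g.1 = 1 := by rw [← Units.val_mul, inv_mul_cancel, Units.val_one]
  -- On a Hermitian matrix `H` both sides are `g (A H + H Aᴴ) gᴴ` up to the factor `|det g|⁻¹`.
  have key : kleinLie (g.1 * A * (g⁻¹).1) * kleinMat g = kleinMat g * kleinLie A := by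
    apply Matrix.ext_of_mulVec_single
    intro j
    generalize (Pi.single j 1 : Fin 4 → ℝ) = t
    have hi' : g.1ᴴ * ((g⁻¹).1)ᴴ = 1 := by rw [← conjTranspose_mul, hi, conjTranspose_one]
    rw [← Matrix.mulVec_mulVec, ← Matrix.mulVec_mulVec, kleinMat_mulVec, kleinLie_mulVec,
      kleinMat_mulVec, kleinLie_mulVec, herm_smul, herm_coord, herm_coord,
      Matrix.mul_smul, Matrix.smul_mul, ← smul_add, coord_smul]
    · congr 2
      rw [conjTranspose_mul, conjTranspose_mul, Matrix.mul_add, Matrix.add_mul]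
      congr 1
      · calc _ = g.1 * A * ((g⁻¹).1 * g.1) * herm t * g.1ᴴ := by simp only [Matrix.mul_assoc]
          _ = _ := by rw [hi, Matrix.mul_one]; simp only [Matrix.mul_assoc]
      · calc _ = g.1 * herm t * (g.1ᴴ * ((g⁻¹).1)ᴴ) * Aᴴ * g.1ᴴ := by
              simp only [Matrix.mul_assoc]
          _ = _ := by rw [hi', Matrix.mul_one]; simp only [Matrix.mul_assoc]
    · simp [herm_isHermitian, add_comm]
    · simp [herm_isHermitian, Matrix.mul_assoc]
  rw [← key, Matrix.mul_assoc _ (kleinMat g), ← kleinMat_mul, mul_inv_cancel, kleinMat_one, Matrix.mul_one]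

lemma kleinLie_eq {A : Matrix (Fin 2) (Fin 2) ℂ} (hA : A.trace = 0) : kleinLie A =
    !![0, -2 * (A 0 0).im, (A 0 1).re / 2 - 2 * (A 1 0).re, (A 0 1).re / 2 + 2 * (A 1 0).re;
       2 * (A 0 0).im, 0, (A 0 1).im / 2 + 2 * (A 1 0).im, (A 0 1).im / 2 - 2 * (A 1 0).im;
       2 * (A 1 0).re - (A 0 1).re / 2, -2 * (A 1 0).im - (A 0 1).im / 2, 0, -2 * (A 0 0).re;
       (A 0 1).re / 2 + 2 * (A 1 0).re, (A 0 1).im / 2 - 2 * (A 1 0).im, -2 * (A 0 0).re, 0] := by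
  have h : A 1 1 = - A 0 0 := by
    rw [trace_fin_two] at hA
    linear_combination hA
  ext i j
  fin_cases i <;> fin_cases j <;>
  simp [kleinLie, coord, herm, Matrix.mul_apply, Fin.sum_univ_two, Pi.single_apply, h, vecMul,
    dotProduct] <;> ring

lemma kleinLie_trace {A : Matrix (Fin 2) (Fin 2) ℂ} (hA : A.trace = 0) :
    (kleinLie A).trace = 0 := by
  simp [kleinLie_eq hA, Matrix.trace, Fin.sum_univ_four]

/-- The inverse of `kleinLie`. -/
def kleinLieInv (B : Matrix (Fin 4) (Fin 4) ℝ) : Matrix (Fin 2) (Fin 2) ℂ :=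
  !![⟨-(B 2 3) / 2, B 1 0 / 2⟩, ⟨B 0 3 + B 0 2, B 1 3 + B 1 2⟩;
     ⟨(B 0 3 - B 0 2) / 4, (B 1 2 - B 1 3) / 4⟩, -⟨-(B 2 3) / 2, B 1 0 / 2⟩]

lemma kleinLieInv_trace (B : Matrix (Fin 4) (Fin 4) ℝ) : (kleinLieInv B).trace = 0 := by
  simp [kleinLieInv, trace_fin_two]

lemma kleinLieInv_add (B C : Matrix (Fin 4) (Fin 4) ℝ) :
    kleinLieInv (B + C) = kleinLieInv B + kleinLieInv C := by
  ext i j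
  fin_cases i <;> fin_cases j <;> simp [kleinLieInv, Complex.ext_iff] <;> constructor <;> ring

lemma kleinLieInv_kleinLie {A : Matrix (Fin 2) (Fin 2) ℂ} (hA : A.trace = 0) :
    kleinLieInv (kleinLie A) = A := by
  have h : A 1 1 = - A 0 0 := by
    rw [trace_fin_two] at hA
    linear_combination hA
  rw [kleinLie_eq hA]
  ext i j
  fin_cases i <;> fin_cases j <;> simp [kleinLieInv, h, Complex.ext_iff] <;> constructor <;> ring

lemma kleinLie_kleinLieInv {B : Matrix (Fin 4) (Fin 4) ℝ} (hB : B ∈ so31) :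
    kleinLie (kleinLieInv B) = B := by
  have h : ∀ i j, (Bᵀ * J) i j = (-(J * B)) i j := fun i j => by rw [hB.2]
  simp only [J, mul_diagonal, diagonal_mul, Matrix.neg_apply, transpose_apply] at h
  have h00 := h 0 0
  have h01 := h 0 1
  have h02 := h 0 2
  have h03 := h 0 3
  have h11 := h 1 1
  have h12 := h 1 2
  have h13 := h 1 3
  have h22 := h 2 2
  have h23 := h 2 3
  have h33 := h 3 3
  simp at h00 h01 h02 h03 h11 h12 h13 h22 h23 h33
  rw [kleinLie_eq (kleinLieInv_trace B)]
  ext i j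
  fin_cases i <;> fin_cases j <;> simp [kleinLieInv] <;> linarith

lemma klein_val (g : GL (Fin 2) ℂ) : (klein g).1.1 = kleinMat g := rfl

lemma klein_inv_val (g : GL (Fin 2) ℂ) : ((klein g).1⁻¹).1 = kleinMat g⁻¹ := by
  rw [← klein_val, map_inv]
  rfl

/-- This equivariance turns crossed homomorphisms into `𝔰𝔬(3, 1)` into crossed homomorphisms into
`𝔰𝔩(2, ℂ)`. -/
lemma kleinLieInv_conj (g : GL (Fin 2) ℂ) {B : Matrix (Fin 4) (Fin 4) ℝ} (hB : B ∈ so31) :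
    kleinLieInv (conj (klein g) B) = g.1 * kleinLieInv B * (g⁻¹).1 := by
  have h : conj (klein g) B = kleinLie (g.1 * kleinLieInv B * (g⁻¹).1) := by
    rw [kleinLie_conj, kleinLie_kleinLieInv hB, ← klein_inv_val]
    rfl
  rw [h, kleinLieInv_kleinLie]
  rw [trace_mul_comm, ← Matrix.mul_assoc, ← Units.val_mul, inv_mul_cancel, Units.val_one,
    Matrix.one_mul, kleinLieInv_trace]

/-! ### The decomposition of `𝔰𝔩(4, ℝ)` -/

lemma J_mul_J : J * J = 1 := by
  ext i j
  fin_cases i <;> fin_cases j <;> simp [J]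

lemma J_transpose : Jᵀ = J := by simp [J]

/-- Taking Lorentzian adjoints gives `tr (A B) = -tr (B A)` for `A` self-adjoint and `B` skew, so
the trace form vanishes. -/
lemma mem_𝔳_of_symm {A : Matrix (Fin 4) (Fin 4) ℝ} (htr : A.trace = 0)
    (hA : Aᵀ * J = J * A) : A ∈ 𝔳 := by
  refine ⟨htr, fun B hB => ?_⟩
  have h1 : (A * B).trace = -(A * B).trace := by
    calc (A * B).trace = (Bᵀ * Aᵀ).trace := by rw [← transpose_mul, trace_transpose]
      _ = (Bᵀ * (Aᵀ * J) * J).trace := by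
          rw [Matrix.mul_assoc, Matrix.mul_assoc, J_mul_J, Matrix.mul_one]
      _ = (Bᵀ * J * (A * J)).trace := by rw [hA]; simp only [Matrix.mul_assoc]
      _ = -(J * B * (A * J)).trace := by rw [hB.2, Matrix.neg_mul, trace_neg]
      _ = -(J * (J * (B * A))).trace := by
          rw [← trace_mul_comm (J * (B * A))]
          simp only [Matrix.mul_assoc]
      _ = -(A * B).trace := by
          rw [← Matrix.mul_assoc, J_mul_J, Matrix.one_mul, trace_mul_comm]
  rw [killing]
  linarith

/-- The adjoint `J Aᵀ J` for the Lorentzian form. -/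
def adjointJ (A : Matrix (Fin 4) (Fin 4) ℝ) : Matrix (Fin 4) (Fin 4) ℝ := J * Aᵀ * J

lemma adjointJ_trace (A : Matrix (Fin 4) (Fin 4) ℝ) : (adjointJ A).trace = A.trace := by
  rw [adjointJ, trace_mul_comm, ← Matrix.mul_assoc, J_mul_J, Matrix.one_mul, trace_transpose]

/-- The Lorentzian adjoint of an element of `SO(3, 1)` is its inverse, so the eigenspaces of
`adjointJ` are submodules. -/
lemma adjointJ_conj (g : SO31) (A : Matrix (Fin 4) (Fin 4) ℝ) :
    adjointJ (conj g A) = conj g (adjointJ A) := by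
  have hg : g.1.1ᵀ * J * g.1.1 = J := g.2.2
  have hi : (g⁻¹).1.1ᵀ * J * (g⁻¹).1.1 = J := (g⁻¹).2.2
  have h1 : g.1.1 * (g⁻¹).1.1 = 1 := by
    rw [Subgroup.coe_inv, ← Units.val_mul, mul_inv_cancel, Units.val_one]
  have h2 : (g⁻¹).1.1ᵀ * J = J * g.1.1 := by
    calc _ = (g⁻¹).1.1ᵀ * J * ((g⁻¹).1.1 * g.1.1) := by
          rw [mul_eq_one_comm.1 h1, Matrix.mul_one]
      _ = J * g.1.1 := by rw [← Matrix.mul_assoc, hi]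
  have h3 : g.1.1ᵀ * J = J * (g⁻¹).1.1 := by
    calc _ = g.1.1ᵀ * J * (g.1.1 * (g⁻¹).1.1) := by rw [h1, Matrix.mul_one]
      _ = J * (g⁻¹).1.1 := by rw [← Matrix.mul_assoc, hg]
  have h4 : J * (g⁻¹).1.1ᵀ = g.1.1 * J := by
    have := congrArg (fun M => J * M * J) h2
    simp only [← Matrix.mul_assoc, J_mul_J, Matrix.one_mul] at this
    rw [Matrix.mul_assoc, J_mul_J, Matrix.mul_one] at this
    exact this
  change J * (g.1.1 * A * (g⁻¹).1.1)ᵀ * J = g.1.1 * (J * Aᵀ * J) * (g⁻¹).1.1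
  calc _ = (J * (g⁻¹).1.1ᵀ) * Aᵀ * (g.1.1ᵀ * J) := by
        simp only [transpose_mul, Matrix.mul_assoc]
    _ = _ := by rw [h4, h3]; simp only [Matrix.mul_assoc]

lemma adjointJ_add (A B : Matrix (Fin 4) (Fin 4) ℝ) :
    adjointJ (A + B) = adjointJ A + adjointJ B := by
  simp [adjointJ, Matrix.mul_add, Matrix.add_mul]

lemma transpose_adjointJ_mul_J (A : Matrix (Fin 4) (Fin 4) ℝ) : (adjointJ A)ᵀ * J = J * A := by
  rw [adjointJ, transpose_mul, transpose_mul, transpose_transpose, J_transpose,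
    ← Matrix.mul_assoc, Matrix.mul_assoc _ J J, J_mul_J, Matrix.mul_one]

lemma J_mul_adjointJ (A : Matrix (Fin 4) (Fin 4) ℝ) : J * adjointJ A = Aᵀ * J := by
  rw [adjointJ, ← Matrix.mul_assoc, ← Matrix.mul_assoc, J_mul_J, Matrix.one_mul]

/-- The component of a matrix in `𝔰𝔬(3, 1)`. -/
def skewPart (A : Matrix (Fin 4) (Fin 4) ℝ) : Matrix (Fin 4) (Fin 4) ℝ :=
  (1 / 2 : ℝ) • (A - adjointJ A)

/-- The component of a trace-free matrix in `𝔳`. -/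
def symmPart (A : Matrix (Fin 4) (Fin 4) ℝ) : Matrix (Fin 4) (Fin 4) ℝ :=
  (1 / 2 : ℝ) • (A + adjointJ A)

lemma skewPart_mem (A : Matrix (Fin 4) (Fin 4) ℝ) : skewPart A ∈ so31 := by
  refine Submodule.smul_mem _ _ ⟨by rw [trace_sub, adjointJ_trace, sub_self], ?_⟩
  rw [transpose_sub, Matrix.sub_mul, Matrix.mul_sub, transpose_adjointJ_mul_J, J_mul_adjointJ,
    neg_sub]

lemma symmPart_mem {A : Matrix (Fin 4) (Fin 4) ℝ} (hA : A ∈ sl4) : symmPart A ∈ 𝔳 := by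
  have hA : A.trace = 0 := hA
  refine Submodule.smul_mem _ _ (mem_𝔳_of_symm (by rw [trace_add, adjointJ_trace, hA, add_zero]) ?_)
  rw [transpose_add, Matrix.add_mul, Matrix.mul_add, transpose_adjointJ_mul_J, J_mul_adjointJ,
    add_comm]

lemma skewPart_add_symmPart (A : Matrix (Fin 4) (Fin 4) ℝ) : skewPart A + symmPart A = A := by
  rw [skewPart, symmPart]
  module

lemma skewPart_add (A B : Matrix (Fin 4) (Fin 4) ℝ) :
    skewPart (A + B) = skewPart A + skewPart B := by
  rw [skewPart, skewPart, skewPart, adjointJ_add]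
  module

lemma symmPart_add (A B : Matrix (Fin 4) (Fin 4) ℝ) :
    symmPart (A + B) = symmPart A + symmPart B := by
  rw [symmPart, symmPart, symmPart, adjointJ_add]
  module

lemma skewPart_conj (g : SO31) (A : Matrix (Fin 4) (Fin 4) ℝ) :
    skewPart (conj g A) = conj g (skewPart A) := by
  rw [skewPart, skewPart, adjointJ_conj, map_smul, map_sub]

lemma symmPart_conj (g : SO31) (A : Matrix (Fin 4) (Fin 4) ℝ) :
    symmPart (conj g A) = conj g (symmPart A) := by
  rw [symmPart, symmPart, adjointJ_conj, map_smul, map_add]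

/-! ### Infinitesimal deformations of the holonomy in `PSL(2, ℂ)` -/

/-- The positivity of the symplectic form of Neumann and Zagier: on the tangent line of the space
of shapes, `p du + q dv` has no zeros for real `(p, q) ≠ 0`. -/
lemma shapes_tangent_eq_zero {z₁ z₂ α₁ α₂ : ℂ} (hz₁ : 0 < z₁.im) (hz₂ : 0 < z₂.im)
    (hedge : 2 * (α₁ / z₁) + α₁ / (1 - z₁) - α₂ / z₂ - 2 * (α₂ / (1 - z₂)) = 0)
    {p q : ℝ} (hpq : p ≠ 0 ∨ q ≠ 0)
    (h : (p : ℂ) * (α₁ / z₁ - α₂ / (1 - z₂)) +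
      q * (-4 * (α₂ / (1 - z₂)) - 2 * (α₂ / z₂)) = 0) : α₁ = 0 ∧ α₂ = 0 := by
  -- With `ω(A, B) = Im (A B̄)`, this is `ω(α / z, α / (1 - z)) = -Im z |α|² / |z (1 - z)|²`.
  have key : ∀ z α : ℂ, 0 < z.im → (α / z).im * (α / (1 - z)).re - (α / z).re * (α / (1 - z)).im ≤ 0
      ∧ ((α / z).im * (α / (1 - z)).re - (α / z).re * (α / (1 - z)).im = 0 → α = 0) := by
    intro z α hz
    have hz0 : z ≠ 0 := fun h => by simp [h] at hz
    have hz1 : 1 - z ≠ 0 := fun h => by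
      rw [← sub_eq_zero.1 h] at hz
      simp at hz
    have n0 := Complex.normSq_pos.2 hz0
    have n1 := Complex.normSq_pos.2 hz1
    have e : (α / z).im * (α / (1 - z)).re - (α / z).re * (α / (1 - z)).im =
        -(z.im * Complex.normSq α) / (Complex.normSq z * Complex.normSq (1 - z)) := by
      rw [Complex.div_re, Complex.div_im, Complex.div_re, Complex.div_im]
      field_simp
      simp only [Complex.normSq_apply, Complex.sub_re, Complex.sub_im, Complex.one_re,
        Complex.one_im]
      ring
    rw [e]
    refine ⟨?_, fun h0 => ?_⟩
    · apply div_nonpos_of_nonpos_of_nonneg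
      · have := mul_nonneg hz.le (Complex.normSq_nonneg α)
        linarith
      · positivity
    · rw [div_eq_zero_iff, neg_eq_zero, mul_eq_zero, mul_eq_zero] at h0
      rcases h0 with (h0 | h0) | (h0 | h0)
      · exact absurd h0 hz.ne'
      · exact Complex.normSq_eq_zero.1 h0
      · exact absurd h0 n0.ne'
      · exact absurd h0 n1.ne'
  obtain ⟨k1, k1'⟩ := key z₁ α₁ hz₁
  obtain ⟨k2, k2'⟩ := key z₂ α₂ hz₂
  generalize α₁ / z₁ = A₁ at *
  generalize α₂ / z₂ = A₂ at *
  generalize α₁ / (1 - z₁) = B₁ at *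
  generalize α₂ / (1 - z₂) = B₂ at *
  have er := congrArg Complex.re hedge
  have ei := congrArg Complex.im hedge
  have hr := congrArg Complex.re h
  have hi := congrArg Complex.im h
  simp at er ei hr hi
  -- A nontrivial real relation between `du` and `dv` gives `ω(du, dv) = 0`.
  have hd : (A₁.im - B₂.im) * (-4 * B₂.re - 2 * A₂.re)
      - (A₁.re - B₂.re) * (-4 * B₂.im - 2 * A₂.im) = 0 := by
    rcases hpq with hp | hq
    · apply mul_left_cancel₀ hp
      linear_combination (-4 * B₂.re - 2 * A₂.re) * hi - (-4 * B₂.im - 2 * A₂.im) * hr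
    · apply mul_left_cancel₀ hq
      linear_combination (A₁.im - B₂.im) * hr - (A₁.re - B₂.re) * hi
  -- Eliminating `A₂` by the edge equation, `ω(du, dv) = -2 (ω(A₁, B₁) + ω(A₂, B₂))`. Both summands
  -- are nonpositive, so each vanishes.
  have hs : (A₁.im * B₁.re - A₁.re * B₁.im) + (A₂.im * B₂.re - A₂.re * B₂.im) = 0 := by
    have e1 : A₂.re = 2 * A₁.re + B₁.re - 2 * B₂.re := by linarith
    have e2 : A₂.im = 2 * A₁.im + B₁.im - 2 * B₂.im := by linarith
    rw [e1, e2] at hd ⊢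
    linear_combination -(1 / 2) * hd
  exact ⟨k1' (by linarith), k2' (by linarith)⟩

/-- The action of `GL(2, ℂ)` on matrices by conjugation. -/
def adGL : Representation ℂ (GL (Fin 2) ℂ) (Matrix (Fin 2) (Fin 2) ℂ) where
  toFun g :=
    { toFun := fun A => g.1 * A * (g⁻¹).1
      map_add' := fun A B => by simp [Matrix.mul_add, Matrix.add_mul]
      map_smul' := fun c A => by simp }
  map_one' := by
    ext1 A
    simp
  map_mul' g h := by
    ext1 A
    simp [Matrix.mul_assoc]

lemma adGL_apply (g : GL (Fin 2) ℂ) (A : Matrix (Fin 2) (Fin 2) ℂ) :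
    adGL g A = g.1 * A * (g⁻¹).1 := rfl

lemma adGL_mul_self (g : GL (Fin 2) ℂ) (A : Matrix (Fin 2) (Fin 2) ℂ) :
    adGL g A * g.1 = g.1 * A := by
  rw [adGL_apply, Matrix.mul_assoc, ← Units.val_mul, inv_mul_cancel, Units.val_one,
    Matrix.mul_one]

lemma trace_adGL (g : GL (Fin 2) ℂ) (A : Matrix (Fin 2) (Fin 2) ℂ) :
    (adGL g A).trace = A.trace := by
  rw [adGL_apply, trace_mul_comm, ← Matrix.mul_assoc, ← Units.val_mul, inv_mul_cancel,
    Units.val_one, Matrix.one_mul]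

lemma trace_adGL_mul (g : GL (Fin 2) ℂ) (A B : Matrix (Fin 2) (Fin 2) ℂ) :
    (adGL g A * (g.1 * B)).trace = (A * B * g.1).trace := by
  rw [← Matrix.mul_assoc, adGL_mul_self, Matrix.mul_assoc, trace_mul_comm]

/-- The homomorphism `g ↦ (1 + ε ζ(g)) ρ(g)` to matrices over the dual numbers which is defined by
a crossed homomorphism `ζ`. -/
def dualHom {G : Type*} [Group G] (ρ : G →* GL (Fin 2) ℂ) (ζ : G → Matrix (Fin 2) (Fin 2) ℂ)
    (hζ : ∀ g h, ζ (g * h) = adGL (ρ g) (ζ h) + ζ g) :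
    G →* Matrix (Fin 2) (Fin 2) (DualNumber ℂ) where
  toFun g := of fun i j =>
    TrivSqZeroExt.inl ((ρ g).1 i j) + TrivSqZeroExt.inr ((ζ g * (ρ g).1) i j)
  map_one' := by
    have h1 : ζ 1 = 0 := by simpa using hζ 1 1
    refine Matrix.ext fun i j => ?_
    fin_cases i <;> fin_cases j <;> simp [h1]
  map_mul' g h := by
    have key : ζ (g * h) * (ρ (g * h)).1 =
        (ρ g).1 * (ζ h * (ρ h).1) + ζ g * (ρ g).1 * (ρ h).1 := by
      rw [hζ, map_mul, Units.val_mul, Matrix.add_mul, ← Matrix.mul_assoc, adGL_mul_self]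
      simp only [Matrix.mul_assoc]
    have key' : (ρ (g * h)).1 = (ρ g).1 * (ρ h).1 := by rw [map_mul, Units.val_mul]
    refine Matrix.ext fun i j => ?_
    simp only [of_apply, key]
    simp only [key', Matrix.mul_apply (M := of _), Fin.sum_univ_two]
    generalize ζ h * (ρ h).1 = D
    generalize ζ g * (ρ g).1 = E
    apply TrivSqZeroExt.ext
    · simp [Matrix.mul_apply, Fin.sum_univ_two]
    · simp [Matrix.mul_apply, Fin.sum_univ_two]
      ring

lemma dualHom_apply {G : Type*} [Group G] (ρ : G →* GL (Fin 2) ℂ)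
    (ζ : G → Matrix (Fin 2) (Fin 2) ℂ) (hζ : ∀ g h, ζ (g * h) = adGL (ρ g) (ζ h) + ζ g) (g : G)
    (i j : Fin 2) : dualHom ρ ζ hζ g i j =
      TrivSqZeroExt.inl ((ρ g).1 i j) + TrivSqZeroExt.inr ((ζ g * (ρ g).1) i j) := rfl

lemma closure_x_y : Subgroup.closure {x, y} = ⊤ := by
  rw [← PresentedGroup.closure_range_of]
  congr 1
  ext g
  simp [x, y, Set.mem_range, Fin.exists_fin_two, eq_comm]

namespace Shapes

variable (S : Shapes)

lemma holGL_x : S.holGL x = S.matX := by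
  simp [holGL, x]

lemma holGL_y : S.holGL y = S.matY := by
  simp [holGL, y]

lemma matX_val : S.matX.1 = !![1, -1; 0, S.w] := rfl

lemma matY_val : S.matY.1 = !![S.w, 0; -S.z₂, 1] := rfl

/-- The holonomy in normal form. -/
lemma holGL_isNormalForm : IsNormalForm ((Units.coeHom _).comp S.holGL) 1
    (Units.mk0 S.w S.w_ne) S.z₂ := by
  constructor
  · simp [holGL_x, matX_val]
  · simp [holGL_y, matY_val]

lemma holGL_l_one_zero : (S.holGL l).1 1 0 = 0 := S.holGL_isNormalForm.map_l_one_zero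

lemma holGL_l_one_one : S.z₂ * (S.holGL l).1 1 1 = (1 - S.z₂) ^ 2 :=
  S.holGL_isNormalForm.map_l_one_one

lemma holGL_l_zero_zero : (1 - S.z₂) ^ 2 * (S.holGL l).1 0 0 = S.z₂ :=
  S.holGL_isNormalForm.map_l_zero_zero

lemma holGL_l_zero_one : (1 - S.w) * (S.holGL l).1 0 1 =
    (S.holGL l).1 1 1 - (S.holGL l).1 0 0 :=
  S.holGL_isNormalForm.map_l_zero_one

lemma holGL_l_comm : S.holGL l * S.matX = S.matX * S.holGL l := by
  apply Units.ext
  rw [Units.val_mul, Units.val_mul]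
  have h1 := S.holGL_l_one_zero
  have h2 := S.holGL_l_zero_one
  ext i j
  fin_cases i <;> fin_cases j <;>
    simp [matX_val, Matrix.mul_apply, Fin.sum_univ_two, h1, mul_comm]
  linear_combination -h2

variable {S}

/-- `tr (ζ g · ρ g)` is the derivative of the trace of `ρ g` along the deformation, and `y = a x
a⁻¹` is conjugate to `x`. -/
lemma trace_crossedHom_y {ζ : KnotGroup → Matrix (Fin 2) (Fin 2) ℂ}
    (hζ : ∀ g h, ζ (g * h) = adGL (S.holGL g) (ζ h) + ζ g) :
    (ζ y * S.matY.1).trace = (ζ x * S.matX.1).trace := by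
  have h1 := hζ a x
  rw [a_mul_x, hζ y a, holGL_y] at h1
  have h2 : ζ y = adGL (S.holGL a) (ζ x) + ζ a - adGL S.matY (ζ a) := by
    rw [← h1]
    abel
  have h3 : S.matY * S.holGL a = S.holGL a * S.matX := by
    rw [← holGL_x, ← holGL_y, ← map_mul, ← map_mul, a_mul_x]
  have h4 : S.matY.1 = (S.holGL a).1 * (S.matX.1 * (S.holGL a)⁻¹.1) := by
    rw [← Units.val_mul, ← Units.val_mul, ← mul_assoc, ← h3, mul_inv_cancel_right]
  have h5 : (adGL S.matY (ζ a) * S.matY.1).trace = (ζ a * S.matY.1).trace := by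
    rw [adGL_mul_self, trace_mul_comm]
  have h6 : (adGL (S.holGL a) (ζ x) * S.matY.1).trace = (ζ x * S.matX.1).trace := by
    conv_lhs => rw [h4]
    rw [trace_adGL_mul, Matrix.mul_assoc, Matrix.mul_assoc, ← Units.val_mul, inv_mul_cancel,
      Units.val_one, Matrix.mul_one]
  rw [h2, Matrix.sub_mul, Matrix.add_mul, trace_sub, trace_add, h5, h6]
  ring

/-- After subtraction of a coboundary a crossed homomorphism is tangent to the space of
representations in normal form. -/
lemma exists_normalize (hw : S.w ≠ 1) {A B : Matrix (Fin 2) (Fin 2) ℂ} :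
    ∃ C : Matrix (Fin 2) (Fin 2) ℂ, C.trace = 0 ∧
      (A - (adGL S.matX C - C)) 0 1 = 0 ∧ (A - (adGL S.matX C - C)) 1 0 = 0 ∧
      (B - (adGL S.matY C - C)) 0 1 = 0 := by
  have hw0 := S.w_ne
  have hw1 : S.w - 1 ≠ 0 := sub_ne_zero.2 hw
  -- The lower left entry of `C` solves the condition on `A 1 0`, the upper right entry the
  -- condition on `B 0 1`; the diagonal is then determined by `A 0 1`.
  refine ⟨!![(S.w * A 0 1 + S.w * (B 0 1 / (S.w - 1)) + A 1 0 / (S.w - 1)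
    - B 0 1 / (S.w - 1)) / 2, B 0 1 / (S.w - 1); A 1 0 / (S.w - 1),
    -((S.w * A 0 1 + S.w * (B 0 1 / (S.w - 1)) + A 1 0 / (S.w - 1)
    - B 0 1 / (S.w - 1)) / 2)], ?_, ?_, ?_, ?_⟩
  · simp [trace_fin_two]
  · rw [adGL_apply, matX_inv, matX_val]
    simp
    field_simp
    ring
  · rw [adGL_apply, matX_inv, matX_val]
    simp
    field_simp
    ring
  · rw [adGL_apply, matY_inv, matY_val]
    simp
    field_simp
    ring

end Shapes

/-- For `m` the meridian holonomy this is a torus-invariant functional on `𝔰𝔩(2, ℂ)`, the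
counterpart of `axisPairing` on `𝔳`. -/
lemma trace_adGL_mul_of_commute {g m : GL (Fin 2) ℂ} (h : Commute g m)
    (A : Matrix (Fin 2) (Fin 2) ℂ) : (adGL g A * m.1).trace = (A * m.1).trace := by
  have h1 : m.1 = g.1 * (g⁻¹ * m).1 := by rw [← Units.val_mul, mul_inv_cancel_left]
  conv_lhs => rw [h1]
  rw [trace_adGL_mul, Matrix.mul_assoc, ← Units.val_mul, mul_assoc, ← h.eq, inv_mul_cancel_left]

namespace Shapes

variable {S : Shapes}

lemma commute_zpow_mul_zpow (p q : ℤ) : Commute (S.holGL (x ^ p * l ^ q)) S.matX := by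
  rw [map_mul, map_zpow, map_zpow, holGL_x]
  exact ((Commute.refl S.matX).zpow_left p).mul_left
    ((show Commute (S.holGL l) S.matX from S.holGL_l_comm).zpow_left q)

/-- A tangent vector `(w', z')` of a deformation of the holonomy in normal form vanishes if
`p du + q dv` vanishes on it. -/
lemma normalForm_tangent_eq_zero {p q : ℝ} (hpq : p ≠ 0 ∨ q ≠ 0) {w' z' : ℂ}
    (hcurve : 2 * S.z₂ * z' - (2 * S.w - 1) * w' * S.z₂ - (S.w ^ 2 - S.w + 1) * z' +
      2 * S.w * w' = 0)
    (h : (p : ℂ) * (w' / S.w) + q * (-4 * (z' / (1 - S.z₂)) - 2 * (z' / S.z₂)) = 0) :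
    w' = 0 ∧ z' = 0 := by
  have h1 := S.z₁_ne
  have h2 := S.z₂_ne
  have h3 := S.one_sub_z₁_ne
  have h4 := S.one_sub_z₂_ne
  have hw := S.w_ne
  have hwd : S.w = S.z₁ * (1 - S.z₂) := rfl
  have hsq := S.w_sq
  -- `α` is the variation of `z₁`, recovered by differentiating `w = z₁ (1 - z₂)`.
  obtain ⟨α, hα⟩ : ∃ α, w' = α * (1 - S.z₂) - S.z₁ * z' :=
    ⟨(w' + S.z₁ * z') / (1 - S.z₂), by field_simp; ring⟩
  have hu : w' / S.w = α / S.z₁ - z' / (1 - S.z₂) := by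
    rw [hα, hwd]
    field_simp
  -- The derivative of `w² = (1 - z₁) z₂`; division by `w²` makes it logarithmic.
  have he : 2 * S.z₁ * α * (1 - S.z₂) ^ 2 - 2 * S.z₁ ^ 2 * (1 - S.z₂) * z' + α * S.z₂
      - (1 - S.z₁) * z' = 0 := by
    apply mul_left_cancel₀ h4
    rw [hα, hwd] at hcurve
    rw [hwd] at hsq
    linear_combination hcurve + z' * hsq
  have hedge : 2 * (α / S.z₁) + α / (1 - S.z₁) - z' / S.z₂ - 2 * (z' / (1 - S.z₂)) = 0 := by
    apply mul_left_cancel₀ (pow_ne_zero 2 hw)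
    rw [mul_zero, ← he]
    have e1 : S.w ^ 2 * (α / S.z₁) = S.z₁ * α * (1 - S.z₂) ^ 2 := by rw [hwd]; field_simp
    have e2 : S.w ^ 2 * (α / (1 - S.z₁)) = α * S.z₂ := by rw [hsq]; field_simp
    have e3 : S.w ^ 2 * (z' / S.z₂) = (1 - S.z₁) * z' := by rw [hsq]; field_simp
    have e4 : S.w ^ 2 * (z' / (1 - S.z₂)) = S.z₁ ^ 2 * (1 - S.z₂) * z' := by
      rw [hwd]; field_simp
    linear_combination 2 * e1 + e2 - e3 - 2 * e4
  rw [hu] at h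
  obtain ⟨ha, hz⟩ := shapes_tangent_eq_zero S.im_pos₁ S.im_pos₂ hedge hpq h
  exact ⟨by rw [hα, ha, hz]; ring, hz⟩

/-- Infinitesimal rigidity in `𝔰𝔩(2, ℂ)`: a crossed homomorphism which vanishes on the filling
curve is principal. -/
theorem crossedHom_sl2_principal (hw : S.w ≠ 1) {p q : ℤ} (hpq : p ≠ 0 ∨ q ≠ 0)
    {ζ : KnotGroup → Matrix (Fin 2) (Fin 2) ℂ}
    (hζ : ∀ g h, ζ (g * h) = adGL (S.holGL g) (ζ h) + ζ g) (htr : ∀ g, (ζ g).trace = 0)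
    (h0 : ζ (x ^ p * l ^ q) = 0) :
    ∃ C : Matrix (Fin 2) (Fin 2) ℂ, C.trace = 0 ∧ ∀ g, ζ g = adGL (S.holGL g) C - C := by
  obtain ⟨C, hC, hx01, hx10, hy01⟩ := S.exists_normalize hw (A := ζ x) (B := ζ y)
  refine ⟨C, hC, fun g => sub_eq_zero.1 ?_⟩
  have hw1 : S.w - 1 ≠ 0 := sub_ne_zero.2 hw
  have hw0 := S.w_ne
  have hz0 := S.z₂_ne
  have hz1 := S.one_sub_z₂_ne
  obtain ⟨η, hη⟩ : ∃ η : KnotGroup → Matrix (Fin 2) (Fin 2) ℂ,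
    ∀ g, η g = ζ g - (adGL (S.holGL g) C - C) := ⟨_, fun _ => rfl⟩
  rw [← hη]
  rw [← holGL_x, ← hη] at hx01 hx10
  rw [← holGL_y, ← hη] at hy01
  have hηc : ∀ g h, η (g * h) = adGL (S.holGL g) (η h) + η g := by
    intro g h
    simp only [hη, hζ, map_mul, Module.End.mul_apply, map_sub]
    abel
  have hηt : ∀ g, η g 0 0 = -η g 1 1 := by
    intro g
    have : (η g).trace = 0 := by
      rw [hη, trace_sub, trace_sub, trace_adGL, htr]
      ring
    rw [trace_fin_two] at this
    linear_combination this
  have hη0 : (η (x ^ p * l ^ q) * S.matX.1).trace = 0 := by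
    rw [hη, h0, zero_sub, Matrix.neg_mul, Matrix.sub_mul, trace_neg, trace_sub,
      trace_adGL_mul_of_commute (commute_zpow_mul_zpow p q), sub_self, neg_zero]
  have hxy := trace_crossedHom_y hηc
  have hy00 : η y 0 0 = η x 1 1 := by
    simp [matX_val, matY_val, trace_fin_two, Matrix.mul_apply, Fin.sum_univ_two, hx01, hx10, hy01]
      at hxy
    apply mul_left_cancel₀ hw1
    have h1 := hηt x
    have h2 := hηt y
    linear_combination hxy + h1 - h2
  generalize ht : η x 1 1 = t at *
  generalize hγ : η y 1 0 = γ at *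
  have hy11 : η y 1 1 = -t := by
    rw [← hy00, hηt, neg_neg]
  have hx00 : η x 0 0 = -t := by rw [hηt, ht]
  -- With `η x = diag(-t, t)` and `η y` lower triangular, `(1 + ε η) ρ` is in normal form with `c =
  -- 1 - t ε`, `W = w (1 + 2 t ε)` and `Z = z₂ - γ w ε`.
  let c : (DualNumber ℂ)ˣ :=
    ⟨TrivSqZeroExt.inl 1 + TrivSqZeroExt.inr (-t), TrivSqZeroExt.inl 1 + TrivSqZeroExt.inr t,
      by apply TrivSqZeroExt.ext <;> simp, by apply TrivSqZeroExt.ext <;> simp⟩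
  let W : (DualNumber ℂ)ˣ :=
    ⟨TrivSqZeroExt.inl S.w + TrivSqZeroExt.inr (2 * S.w * t),
      TrivSqZeroExt.inl S.w⁻¹ + TrivSqZeroExt.inr (-2 * t * S.w⁻¹),
      by apply TrivSqZeroExt.ext <;> simp [hw0] <;> field_simp <;> ring,
      by apply TrivSqZeroExt.ext <;> simp [hw0] <;> field_simp <;> ring⟩
  let Z : DualNumber ℂ := TrivSqZeroExt.inl S.z₂ + TrivSqZeroExt.inr (-γ * S.w)
  have hF : IsNormalForm (dualHom S.holGL η hηc) c W Z := by
    constructor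
    · refine Matrix.ext fun i j => ?_
      rw [dualHom_apply, holGL_x, matX_val]
      fin_cases i <;> fin_cases j <;> apply TrivSqZeroExt.ext <;>
        simp [c, W, Matrix.mul_apply, Fin.sum_univ_two, hx00, hx01, hx10, ht]
      ring
    · refine Matrix.ext fun i j => ?_
      rw [dualHom_apply, holGL_y, matY_val]
      fin_cases i <;> fin_cases j <;> apply TrivSqZeroExt.ext <;>
        simp [c, W, Z, Matrix.mul_apply, Fin.sum_univ_two, hy00, hy01, hy11, hγ] <;> ring
  have hcurve := congrArg TrivSqZeroExt.snd hF.curve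
  have hl10 := congrArg TrivSqZeroExt.snd hF.map_l_one_zero
  have hl11 := congrArg TrivSqZeroExt.snd hF.map_l_one_one
  have l00 := S.holGL_l_zero_zero
  have l10 := S.holGL_l_one_zero
  have l11 := S.holGL_l_one_one
  rw [dualHom_apply] at hl10 hl11
  simp [Matrix.mul_apply, Fin.sum_univ_two, l10, W, Z, pow_two] at hcurve hl10 hl11
  have hη10 : η l 1 0 = 0 := by
    rcases hl10 with h | h
    · exact h
    · rw [h, mul_zero] at l00
      exact absurd l00.symm hz0
  have hv : η l 1 1 = γ * S.w * (2 / (1 - S.z₂) + 1 / S.z₂) := by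
    field_simp
    apply mul_left_cancel₀ hz1
    rw [hη10] at hl11
    linear_combination S.z₂ * hl11 + (γ * S.w - S.z₂ * η l 1 1) * l11
  let P : Matrix (Fin 2) (Fin 2) ℂ →ₗ[ℂ] ℂ :=
    (traceLinearMap (Fin 2) ℂ ℂ).comp (LinearMap.mulRight ℂ S.matX.1)
  -- On `η x` and `η l` the functional equals `w - 1` times `t` and `η l 1 1`, which are `du / 2`
  -- and `dv / 2`; so its vanishing on the filling curve is `p du + q dv = 0`.
  have hP := invariant_crossedHom_zpow_mul_zpow (adGL.comp S.holGL) hηc P (g := x) (h := l)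
    (fun A => trace_adGL_mul_of_commute (by rw [holGL_x]) A)
    (fun A => trace_adGL_mul_of_commute S.holGL_l_comm A) p q
  have hP' : ∀ A, P A = (A * S.matX.1).trace := fun _ => rfl
  rw [hP', hP', hP', hη0] at hP
  simp [matX_val, trace_fin_two, Matrix.mul_apply, Fin.sum_univ_two, hηt, hx10, hη10, ht] at hP
  have hpq' : (p : ℝ) ≠ 0 ∨ (q : ℝ) ≠ 0 := by simpa using hpq
  have huv : (p : ℂ) * t + q * η l 1 1 = 0 := by
    apply mul_left_cancel₀ hw1
    linear_combination -hP
  obtain ⟨e1, e2⟩ := S.normalForm_tangent_eq_zero hpq' (w' := 2 * S.w * t) (z' := -γ * S.w)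
    (by linear_combination hcurve) (by
      have e : 2 * S.w * t / S.w = 2 * t := by field_simp
      rw [hv] at huv
      push_cast
      linear_combination 2 * huv + p * e)
  have et : t = 0 := by simpa [hw0] using e1
  have eγ : γ = 0 := by simpa [hw0] using e2
  refine crossedHom_eq_zero_of_closure (adGL.comp S.holGL) hηc closure_x_y ?_ g
  rintro g (rfl | rfl)
  · ext i j
    fin_cases i <;> fin_cases j <;> simp [hx00, hx01, hx10, ht, et]
  · ext i j
    fin_cases i <;> fin_cases j <;> simp [hy00, hy01, hy11, hγ, et, eγ]

end Shapes

namespace Shapes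

variable {S : Shapes}

/-! ### The holonomy of the filling -/

lemma z₂_eq_exp_of_w_eq_one (hw : S.w = 1) : S.z₂ = Complex.exp ((Real.pi / 3 : ℝ) * Complex.I) := by
  have h := S.rel_aux
  rw [hw] at h
  have hr := congrArg Complex.re h
  have hi := congrArg Complex.im h
  have him := S.im_pos₂
  simp at hr hi
  have hre : S.z₂.re = 1 / 2 := by
    have : S.z₂.im * (S.z₂.re - 1 / 2) = 0 := by linarith
    rcases mul_eq_zero.1 this with h0 | h0
    · exact absurd h0 him.ne'
    · linarith
  have him' : S.z₂.im = √3 / 2 := by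
    rw [hre] at hr
    have h3 : √3 * √3 = 3 := Real.mul_self_sqrt (by norm_num)
    have h3' := Real.sqrt_nonneg 3
    nlinarith
  rw [Complex.exp_mul_I, ← Complex.ofReal_cos, ← Complex.ofReal_sin, Real.cos_pi_div_three,
    Real.sin_pi_div_three]
  apply Complex.ext <;> simp [hre, him']

/-- The complete structure has no Dehn filling coefficients. -/
lemma w_ne_one {p q : ℝ} (h : S.IsDehnFillingCoeff p q) : S.w ≠ 1 := by
  intro hw
  have hz := S.z₂_eq_exp_of_w_eq_one hw
  have hz' : 1 - S.z₂ = Complex.exp ((-(Real.pi / 3) : ℝ) * Complex.I) := by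
    rw [hz, Complex.exp_mul_I, Complex.exp_mul_I, ← Complex.ofReal_cos, ← Complex.ofReal_sin,
      ← Complex.ofReal_cos, ← Complex.ofReal_sin, Real.cos_neg, Real.sin_neg,
      Real.cos_pi_div_three]
    apply Complex.ext <;> simp
    norm_num
  have hpi := Real.pi_pos
  have hlog : ∀ t : ℝ, -Real.pi < t → t ≤ Real.pi →
      Complex.log (Complex.exp (t * Complex.I)) = t * Complex.I := by
    intro t h1 h2
    apply Complex.log_exp <;> simpa
  have hu : S.u = 0 := by
    change Complex.log S.w = 0
    rw [hw, Complex.log_one]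
  have hv : S.v = 0 := by
    rw [v, hz', hz, hlog _ (by linarith) (by linarith), hlog _ (by linarith) (by linarith)]
    push_cast
    ring
  rw [IsDehnFillingCoeff, hu, hv, mul_zero, mul_zero, add_zero] at h
  exact Complex.two_pi_I_ne_zero h.symm

lemma entries_of_commute (hw : S.w ≠ 1) {g : GL (Fin 2) ℂ} (h : Commute g S.matX) :
    g.1 1 0 = 0 ∧ (S.w - 1) * g.1 0 1 = g.1 0 0 - g.1 1 1 := by
  have hw1 : S.w - 1 ≠ 0 := sub_ne_zero.2 hw
  have h1 : g.1 * S.matX.1 = S.matX.1 * g.1 := congrArg Units.val h.eq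
  rw [matX_val] at h1
  have h10 := congrFun (congrFun h1 1) 0
  have h01 := congrFun (congrFun h1 0) 1
  simp [Matrix.mul_apply, Fin.sum_univ_two] at h10 h01
  refine ⟨?_, by linear_combination h01⟩
  apply mul_left_cancel₀ hw1
  linear_combination -h10

/-- The diagonal entries, as homomorphisms on the centralizer of the holonomy of the meridian. -/
def diagHom (hw : S.w ≠ 1) (i : Fin 2) : Subgroup.centralizer {S.matX} →* ℂ where
  toFun g := g.1.1 i i
  map_one' := by simp
  map_mul' g h := by
    have hc : ∀ k : Subgroup.centralizer {S.matX}, Commute k.1 S.matX := fun k =>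
      (Subgroup.mem_centralizer_singleton_iff.1 k.2)
    have h1 := (entries_of_commute hw (hc g)).1
    have h2 := (entries_of_commute hw (hc h)).1
    fin_cases i <;> simp [Matrix.mul_apply, Fin.sum_univ_two, h1, h2]

lemma diag_zpow_mul_zpow (hw : S.w ≠ 1) (i : Fin 2) (p q : ℤ) :
    (S.holGL (x ^ p * l ^ q)).1 i i = S.matX.1 i i ^ p * (S.holGL l).1 i i ^ q := by
  let X : Subgroup.centralizer {S.matX} :=
    ⟨S.matX, Subgroup.mem_centralizer_singleton_iff.2 rfl⟩
  let L : Subgroup.centralizer {S.matX} :=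
    ⟨S.holGL l, Subgroup.mem_centralizer_singleton_iff.2 S.holGL_l_comm⟩
  have h := map_mul (diagHom hw i) (X ^ p) (L ^ q)
  rw [map_zpow, map_zpow] at h
  rw [map_mul, map_zpow, map_zpow, holGL_x]
  exact h

lemma exp_u : Complex.exp S.u = S.w := Complex.exp_log S.w_ne

/-- `exp v` is the eigenvalue ratio of the longitude; the branch term of `v` contributes `exp (2 π
i) = 1`. -/
lemma exp_v : Complex.exp S.v * (S.holGL l).1 0 0 = (S.holGL l).1 1 1 := by
  have h1 := S.z₂_ne
  have h2 := S.one_sub_z₂_ne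
  have l00 := S.holGL_l_zero_zero
  have l11 := S.holGL_l_one_one
  have e : Complex.exp S.v = ((1 - S.z₂) ^ 2 / S.z₂) ^ 2 := by
    rw [v, two_mul, Complex.exp_add, Complex.exp_add, Complex.exp_sub, two_mul, Complex.exp_add,
      Complex.exp_log h1, Complex.exp_log h2, Complex.exp_pi_mul_I]
    ring
  have e0 : (S.holGL l).1 0 0 = S.z₂ / (1 - S.z₂) ^ 2 := by
    field_simp
    linear_combination l00
  have e1 : (S.holGL l).1 1 1 = (1 - S.z₂) ^ 2 / S.z₂ := by
    field_simp
    linear_combination l11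
  rw [e, e0, e1]
  field_simp

/-- Exponentiating `p u + q v = 2 π i` equates the diagonal entries. A matrix commuting with the
meridian and having equal diagonal entries is scalar when `w ≠ 1`, and scalars act trivially in the
Klein model. -/
lemma hol_filling_eq_one {p q : ℤ} (h : S.IsDehnFillingCoeff p q) :
    S.hol (x ^ p * l ^ q) = 1 := by
  have hw := S.w_ne_one h
  have e := congrArg Complex.exp h
  rw [Complex.exp_two_pi_mul_I, Complex.exp_add, Complex.ofReal_intCast, Complex.ofReal_intCast,
    Complex.exp_int_mul, Complex.exp_int_mul, exp_u] at e
  have d0 := S.diag_zpow_mul_zpow hw 0 p q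
  have d1 := S.diag_zpow_mul_zpow hw 1 p q
  rw [← exp_v, mul_zpow, ← mul_assoc] at d1
  simp only [matX_val, of_apply, cons_val', cons_val_zero, cons_val_one, _root_.one_zpow, one_mul,
    cons_val_fin_one] at d0 d1
  rw [e, one_mul] at d1
  obtain ⟨m10, m01⟩ := entries_of_commute hw (S.commute_zpow_mul_zpow p q)
  have hs : (S.holGL (x ^ p * l ^ q)).1 =
      ((S.holGL l).1 0 0 ^ q) • (1 : Matrix (Fin 2) (Fin 2) ℂ) := by
    have m01' : (S.holGL (x ^ p * l ^ q)).1 0 1 = 0 := by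
      apply mul_left_cancel₀ (sub_ne_zero.2 hw)
      rw [m01, d0, d1, sub_self, mul_zero]
    ext i j
    fin_cases i <;> fin_cases j
    · simpa using d0
    · simpa using m01'
    · simpa using m10
    · simpa using d1
  exact Subtype.ext (Units.ext (kleinMat_eq_one_of_scalar hs))

/-! ### The invariant line in `𝔳` -/

/-- The trace-free part of the holonomy of the meridian. -/
def axis (hw : S.w ≠ 1) : GL (Fin 2) ℂ :=
  GeneralLinearGroup.mkOfDetNeZero !![(1 - S.w) / 2, -1; 0, (S.w - 1) / 2] (by
    have h1 : S.w - 1 ≠ 0 := sub_ne_zero.2 hw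
    have h2 : 1 - S.w ≠ 0 := sub_ne_zero.2 (Ne.symm hw)
    simp [det_fin_two, h1, h2])

lemma axis_val (hw : S.w ≠ 1) :
    (axis hw).1 = !![(1 - S.w) / 2, -1; 0, (S.w - 1) / 2] := rfl

lemma commute_axis (hw : S.w ≠ 1) {g : GL (Fin 2) ℂ} (h : Commute g S.matX) :
    Commute g (axis hw) := by
  have e : (axis hw).1 = S.matX.1 - ((1 + S.w) / 2) • (1 : Matrix (Fin 2) (Fin 2) ℂ) := by
    rw [axis_val, matX_val]
    ext i j
    fin_cases i <;> fin_cases j <;> simp <;> ring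
  have h1 : g.1 * S.matX.1 = S.matX.1 * g.1 := congrArg Units.val h.eq
  apply Units.ext
  rw [Units.val_mul, Units.val_mul, e, Matrix.mul_sub, Matrix.sub_mul, h1]
  simp

/-- A trace-free `2 × 2` matrix has scalar square. An involution in `SO(3, 1)` is self-adjoint for
`J`, which is how the half turn becomes a vector of `𝔳`. -/
lemma kleinMat_axis_mul_self (hw : S.w ≠ 1) : kleinMat (axis hw) * kleinMat (axis hw) = 1 := by
  rw [← kleinMat_mul]
  apply kleinMat_eq_one_of_scalar (μ := ((1 - S.w) / 2) ^ 2)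
  rw [Units.val_mul, axis_val]
  ext i j
  fin_cases i <;> fin_cases j <;> simp [Matrix.mul_apply, Fin.sum_univ_two] <;> ring

/-- The invariant vector of the boundary torus in `𝔳`. -/
def axisVec (hw : S.w ≠ 1) : 𝔳 := ⟨kleinMat (axis hw), mem_𝔳_of_symm (by
    rw [kleinMat_trace]
    simp [axis_val, trace_fin_two, ← add_div]) (by
    have h := kleinMat_lorentz (axis hw)
    calc _ = (kleinMat (axis hw))ᵀ * J * (kleinMat (axis hw) * kleinMat (axis hw)) := by
          rw [kleinMat_axis_mul_self, Matrix.mul_one]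
      _ = _ := by rw [← Matrix.mul_assoc, h])⟩

lemma AdV_val (g : SO31) (A : 𝔳) : (AdV g A : Matrix (Fin 4) (Fin 4) ℝ) =
    g.1.1 * A.1 * (g.1⁻¹).1 := rfl

/-- The pairing with `axisVec` under the trace form. -/
def axisPairing (hw : S.w ≠ 1) : 𝔳 →ₗ[ℝ] ℝ :=
  (traceLinearMap (Fin 4) ℝ ℝ).comp
    ((LinearMap.mulRight ℝ (kleinMat (axis hw))).comp (𝔳).subtype)

lemma axisPairing_apply (hw : S.w ≠ 1) (A : 𝔳) :
    axisPairing hw A = (A.1 * kleinMat (axis hw)).trace := rfl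

lemma axisPairing_axisVec (hw : S.w ≠ 1) : axisPairing hw (axisVec hw) = 4 := by
  change (kleinMat (axis hw) * kleinMat (axis hw)).trace = 4
  rw [kleinMat_axis_mul_self]
  simp

lemma axisVec_ne_zero (hw : S.w ≠ 1) : axisVec hw ≠ 0 := by
  intro h
  have := axisPairing_axisVec hw
  rw [h, map_zero] at this
  norm_num at this

lemma hol_mul_kleinMat_axis (hw : S.w ≠ 1) {g : KnotGroup} (hg : Commute (S.holGL g) S.matX) :
    (S.hol g).1.1 * kleinMat (axis hw) = kleinMat (axis hw) * (S.hol g).1.1 := by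
  change kleinMat (S.holGL g) * _ = _ * kleinMat (S.holGL g)
  rw [← kleinMat_mul, ← kleinMat_mul, (commute_axis hw hg).eq]

lemma AdV_axisVec (hw : S.w ≠ 1) {g : KnotGroup} (hg : Commute (S.holGL g) S.matX) :
    AdV (S.hol g) (axisVec hw) = axisVec hw := by
  apply Subtype.ext
  rw [AdV_val]
  change (S.hol g).1.1 * kleinMat (axis hw) * _ = kleinMat (axis hw)
  rw [hol_mul_kleinMat_axis hw hg, Matrix.mul_assoc, ← Units.val_mul, mul_inv_cancel,
    Units.val_one, Matrix.mul_one]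

lemma axisPairing_AdV (hw : S.w ≠ 1) {g : KnotGroup} (hg : Commute (S.holGL g) S.matX) (A : 𝔳) :
    axisPairing hw (AdV (S.hol g) A) = axisPairing hw A := by
  have h1 : ((S.hol g).1⁻¹).1 * (S.hol g).1.1 = 1 := by
    rw [← Units.val_mul, inv_mul_cancel, Units.val_one]
  rw [axisPairing_apply, axisPairing_apply, AdV_val, Matrix.mul_assoc, Matrix.mul_assoc,
    trace_mul_comm, Matrix.mul_assoc, Matrix.mul_assoc, ← hol_mul_kleinMat_axis hw hg,
    ← Matrix.mul_assoc _ (S.hol g).1.1, h1, Matrix.one_mul]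

lemma fixedBy_eq_span (hw : S.w ≠ 1) {g : KnotGroup} (hg : Commute (S.holGL g) S.matX)
    (hfin : Module.finrank ℝ (S.fixedBy g) = 1) :
    S.fixedBy g = Submodule.span ℝ {axisVec hw} := by
  symm
  apply Submodule.eq_of_le_of_finrank_eq
  · rw [Submodule.span_singleton_le_iff_mem]
    change axisVec hw - AdV (S.hol g) (axisVec hw) = 0
    rw [AdV_axisVec hw hg, sub_self]
  · rw [hfin, finrank_span_singleton (axisVec_ne_zero hw)]

/-- An invariant functional kills `im (1 - g)`. Both subspaces have codimension one: the image
because the invariants are a line, the kernel because the pairing is `4` on `axisVec`. -/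
lemma mem_imageOf_iff (hw : S.w ≠ 1) {g : KnotGroup} (hg : Commute (S.holGL g) S.matX)
    (hfin : Module.finrank ℝ (S.fixedBy g) = 1) (A : 𝔳) :
    A ∈ S.imageOf g ↔ axisPairing hw A = 0 := by
  suffices h : S.imageOf g = LinearMap.ker (axisPairing hw) by rw [h, LinearMap.mem_ker]
  apply Submodule.eq_of_le_of_finrank_eq
  · rintro _ ⟨B, rfl⟩
    change axisPairing hw (B - AdV (S.hol g) B) = 0
    rw [map_sub, axisPairing_AdV hw hg, sub_self]
  · have h1 := LinearMap.finrank_range_add_finrank_ker (S.oneSub g)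
    have h2 := LinearMap.finrank_range_add_finrank_ker (axisPairing hw)
    have h3 : LinearMap.range (axisPairing hw) = ⊤ := by
      rw [LinearMap.range_eq_top]
      apply LinearMap.surjective
      intro h0
      have := axisPairing_axisVec hw
      rw [h0] at this
      norm_num at this
    rw [h3, finrank_top, Module.finrank_self] at h2
    change Module.finrank ℝ (S.imageOf g) + Module.finrank ℝ (S.fixedBy g) = _ at h1
    rw [hfin] at h1
    omega

end Shapes

namespace Shapes

open groupCohomology

variable {S : Shapes}

/-! ### The slope -/

lemma commute_x : Commute (S.holGL x) S.matX := by
  rw [holGL_x]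

lemma axisPairing_ne_zero (hw : S.w ≠ 1) (hdim : Module.finrank ℝ (H1 S.𝔳u) = 1)
    {g : KnotGroup} (hc : Commute (S.holGL g) S.matX)
    (hg : Function.Bijective (S.resCircle g)) {z : cocycles₁ S.𝔳u} (hz : H1π S.𝔳u z ≠ 0) :
    axisPairing hw (z g) ≠ 0 := by
  intro h
  rw [← mem_imageOf_iff hw hc (S.finrank_fixedBy hdim hg), ← resCircle_eq_zero_iff] at h
  exact hz (hg.1 (h.trans (map_zero (S.resCircle g).hom).symm))

lemma axisPairing_smul_sub (hw : S.w ≠ 1) {g : KnotGroup} (hc : Commute (S.holGL g) S.matX)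
    {z z' : cocycles₁ S.𝔳u} {k : ℝ} (h : k • H1π S.𝔳u z = H1π S.𝔳u z') :
    axisPairing hw (z' g) = k * axisPairing hw (z g) := by
  have h1 : H1π S.𝔳u (z' - k • z) = 0 :=
    ((H1π S.𝔳u).hom.map_sub z' (k • z)).trans
      (sub_eq_zero.2 (h.symm.trans ((H1π S.𝔳u).hom.map_smul k z).symm))
  obtain ⟨v, hv⟩ := (H1π_eq_zero_iff_exists _).1 h1
  have h2 : (z' g : 𝔳) - k • (z g : 𝔳) = AdV (S.hol g) v - v := hv g
  have h3 := congrArg (axisPairing hw) h2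
  rw [map_sub, map_sub, map_smul, axisPairing_AdV hw hc, sub_self, sub_eq_zero] at h3
  exact h3

/-- The slope is computed by any crossed homomorphism with nonzero class. -/
lemma isSlope_iff (hw : S.w ≠ 1) (hdim : Module.finrank ℝ (H1 S.𝔳u) = 1)
    (hx : Function.Bijective (S.resCircle x)) (hl : Function.Bijective (S.resCircle l))
    {z : cocycles₁ S.𝔳u} (hz : H1π S.𝔳u z ≠ 0) (s : ℝ) :
    S.IsSlope s ↔ s = axisPairing hw (z x) / axisPairing hw (z l) := by
  have hcl : Commute (S.holGL l) S.matX := S.holGL_l_comm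
  have fx := S.finrank_fixedBy hdim hx
  have fl := S.finrank_fixedBy hdim hl
  constructor
  · rintro ⟨a', z', c₁, c₂, ha, hax, -, hz', h1, h2, rfl⟩
    have ha' : a' ∈ Submodule.span ℝ {axisVec hw} := by
      rw [← fixedBy_eq_span hw commute_x fx, hax]
      exact Submodule.mem_span_singleton_self a'
    obtain ⟨r, rfl⟩ := Submodule.mem_span_singleton.1 ha'
    have hr : r ≠ 0 := by
      rintro rfl
      simp at ha
    rw [mem_imageOf_iff hw commute_x fx, map_sub, map_smul, map_smul, axisPairing_axisVec,
      smul_eq_mul, smul_eq_mul, sub_eq_zero] at h1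
    rw [mem_imageOf_iff hw hcl fl, map_sub, map_smul, map_smul, axisPairing_axisVec,
      smul_eq_mul, smul_eq_mul, sub_eq_zero] at h2
    obtain ⟨k, hk⟩ := (finrank_eq_one_iff_of_nonzero' _ hz).1 hdim (H1π S.𝔳u z')
    have hk0 : k ≠ 0 := by
      rintro rfl
      rw [zero_smul] at hk
      exact hz' hk.symm
    rw [axisPairing_smul_sub hw commute_x hk] at h1
    rw [axisPairing_smul_sub hw hcl hk] at h2
    -- Rescaling the class by `k` and the invariant vector by `r` affects both coefficients alike,
    -- so the quotient is unchanged.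
    rw [← mul_div_mul_left (axisPairing hw (z x)) _ hk0, h1, h2,
      mul_div_mul_right _ _ (mul_ne_zero hr four_ne_zero)]
  · rintro rfl
    refine ⟨axisVec hw, z, axisPairing hw (z x) / 4, axisPairing hw (z l) / 4,
      axisVec_ne_zero hw, fixedBy_eq_span hw commute_x fx, fixedBy_eq_span hw hcl fl, hz, ?_, ?_,
      ?_⟩
    · rw [mem_imageOf_iff hw commute_x fx, map_sub, map_smul, axisPairing_axisVec, smul_eq_mul]
      ring
    · rw [mem_imageOf_iff hw hcl fl, map_sub, map_smul, axisPairing_axisVec, smul_eq_mul]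
      ring
    · rw [div_div_div_cancel_right₀ four_ne_zero]

lemma existsUnique_isSlope (hw : S.w ≠ 1) (hdim : Module.finrank ℝ (H1 S.𝔳u) = 1)
    (hx : Function.Bijective (S.resCircle x)) (hl : Function.Bijective (S.resCircle l)) :
    ∃! s : ℝ, S.IsSlope s := by
  have : Nontrivial (H1 S.𝔳u) := Module.nontrivial_of_finrank_pos (R := ℝ) (by omega)
  obtain ⟨c, hc⟩ := exists_ne (0 : H1 S.𝔳u)
  induction c using H1_induction_on with
  | _ z =>
    simp only [isSlope_iff hw hdim hx hl hc]
    exact existsUnique_eq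

/-- If the slope is not `-q / p`, then a class which vanishes on the filling curve is zero. -/
lemma H1π_eq_zero_of_filling (hw : S.w ≠ 1) (hdim : Module.finrank ℝ (H1 S.𝔳u) = 1)
    (hx : Function.Bijective (S.resCircle x)) (hl : Function.Bijective (S.resCircle l))
    {p q : ℤ} (hpq : p ≠ 0 ∨ q ≠ 0) (hs : S.slope ≠ -(q : ℝ) / (p : ℝ)) {z : cocycles₁ S.𝔳u}
    (h0 : (z (x ^ p * l ^ q) : 𝔳) = 0) : H1π S.𝔳u z = 0 := by
  by_contra hz
  have hcl : Commute (S.holGL l) S.matX := S.holGL_l_comm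
  have hslope : S.IsSlope S.slope :=
    Classical.epsilon_spec (existsUnique_isSlope hw hdim hx hl).exists
  rw [isSlope_iff hw hdim hx hl hz] at hslope
  have hzl := axisPairing_ne_zero hw hdim hcl hl hz
  have h1 := invariant_crossedHom_zpow_mul_zpow (AdV.comp S.hol) (f := z) (cocycles₁_map_mul z)
    (axisPairing hw) (axisPairing_AdV hw commute_x) (axisPairing_AdV hw hcl) p q
  rw [h0, map_zero, zsmul_eq_mul, zsmul_eq_mul] at h1
  -- For `p = 0` the relation is `q P (z l) = 0` with both factors nonzero. Here `-q / p` takes the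
  -- default value `0`, which the slope never attains since `P (z x) ≠ 0`, so the condition is
  -- automatic.
  by_cases hp : p = 0
  · have hq : (q : ℝ) ≠ 0 := by
      rcases hpq with h | h
      · exact absurd hp h
      · exact_mod_cast h
    rw [hp, Int.cast_zero, zero_mul, zero_add] at h1
    rcases mul_eq_zero.1 h1.symm with h | h
    · exact hq h
    · exact hzl h
  · have hp' : (p : ℝ) ≠ 0 := by exact_mod_cast hp
    apply hs
    rw [hslope, div_eq_div_iff hzl hp']
    linear_combination -h1

/-! ### Rigidity of the filling -/

/-- The holonomy of the filling. -/
def fillingHol {p q : ℤ} (h : S.IsDehnFillingCoeff p q) : FilledGroup p q →* SO31 :=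
  QuotientGroup.lift _ S.hol (by
    refine Subgroup.normalClosure_le_normal (N := S.hol.ker) ?_
    rintro _ rfl
    exact hol_filling_eq_one h)

lemma fillingHol_mk {p q : ℤ} (h : S.IsDehnFillingCoeff p q) (g : KnotGroup) :
    fillingHol h (QuotientGroup.mk g) = S.hol g := rfl

lemma mk_filling (p q : ℤ) :
    (QuotientGroup.mk (x ^ p * l ^ q) : FilledGroup p q) = 1 :=
  (QuotientGroup.eq_one_iff _).2 (Subgroup.subset_normalClosure rfl)

lemma subsingleton_H1 {G : Type} [Group G] {A : Rep ℝ G} (h : ∀ z : cocycles₁ A, H1π A z = 0) :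
    Subsingleton (H1 A) := by
  refine ⟨fun c d => ?_⟩
  have h' : ∀ c : H1 A, c = 0 := by
    intro c
    induction c using H1_induction_on with
    | _ z => exact h z
  rw [h' c, h' d]

/-- Pulled back to the knot group, a cocycle vanishes on the filling curve. A vector that
trivialises the pullback also trivialises the cocycle, because the quotient map is surjective and
compatible with the actions. -/
lemma subsingleton_H1_twistedV (hdim : Module.finrank ℝ (H1 S.𝔳u) = 1)
    (hx : Function.Bijective (S.resCircle x)) (hl : Function.Bijective (S.resCircle l))
    {p q : ℤ} (hpq : p ≠ 0 ∨ q ≠ 0) (h : S.IsDehnFillingCoeff p q)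
    (hs : S.slope ≠ -(q : ℝ) / (p : ℝ)) : Subsingleton (H1 (twistedV (fillingHol h))) := by
  refine subsingleton_H1 fun z => ?_
  let z' : cocycles₁ S.𝔳u := ⟨fun g => z (QuotientGroup.mk g), (mem_cocycles₁_iff _).2
    fun g g' => cocycles₁_map_mul z (QuotientGroup.mk g) (QuotientGroup.mk g')⟩
  have h0 : (z' (x ^ p * l ^ q) : 𝔳) = 0 := by
    change z (QuotientGroup.mk (x ^ p * l ^ q)) = 0
    rw [mk_filling, cocycles₁_map_one]
  obtain ⟨v, hv⟩ := (H1π_eq_zero_iff_exists _).1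
    (H1π_eq_zero_of_filling (S.w_ne_one h) hdim hx hl hpq hs h0)
  refine (H1π_eq_zero_iff_exists _).2 ⟨v, fun g => ?_⟩
  induction g using QuotientGroup.induction_on with
  | H g => exact hv g

lemma crossedHom_so31_principal {p q : ℤ} (hpq : p ≠ 0 ∨ q ≠ 0) (h : S.IsDehnFillingCoeff p q)
    {f : FilledGroup p q → Matrix (Fin 4) (Fin 4) ℝ}
    (hf : ∀ g g', f (g * g') = conj (fillingHol h g) (f g') + f g) (hso : ∀ g, f g ∈ so31) :
    ∃ B : Matrix (Fin 4) (Fin 4) ℝ, B ∈ sl4 ∧ ∀ g, f g = conj (fillingHol h g) B - B := by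
  have h1 : f 1 = 0 := by simpa using hf 1 1
  have hζ : ∀ g g' : KnotGroup, kleinLieInv (f (QuotientGroup.mk (g * g'))) =
      adGL (S.holGL g) (kleinLieInv (f (QuotientGroup.mk g'))) +
        kleinLieInv (f (QuotientGroup.mk g)) := by
    intro g g'
    have hg : S.hol g = klein (S.holGL g) := rfl
    rw [QuotientGroup.mk_mul, hf, kleinLieInv_add, fillingHol_mk, hg,
      kleinLieInv_conj _ (hso _), adGL_apply]
  have h0 : kleinLieInv (f (QuotientGroup.mk (x ^ p * l ^ q))) = 0 := by
    have e := kleinLieInv_add 0 0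
    rw [add_zero, left_eq_add] at e
    rw [mk_filling, h1, e]
  obtain ⟨C, hC, hC'⟩ := crossedHom_sl2_principal (S.w_ne_one h) hpq
    (ζ := fun g => kleinLieInv (f (QuotientGroup.mk g))) hζ (fun g => kleinLieInv_trace _) h0
  refine ⟨kleinLie C, kleinLie_trace hC, fun g => ?_⟩
  induction g using QuotientGroup.induction_on with
  | H g =>
    rw [← kleinLie_kleinLieInv (hso _), hC', kleinLie_sub, adGL_apply, kleinLie_conj,
      ← klein_inv_val]
    rfl

lemma rigid_of_subsingleton {p q : ℤ} (hpq : p ≠ 0 ∨ q ≠ 0) (h : S.IsDehnFillingCoeff p q)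
    (hV : Subsingleton (H1 (twistedV (fillingHol h)))) :
    InfinitesimallyProjectivelyRigid (fillingHol h) := by
  refine subsingleton_H1 fun z => ?_
  obtain ⟨f, hf⟩ : ∃ f : FilledGroup p q → sl4, ∀ g, f g = z g := ⟨z, fun _ => rfl⟩
  have hval : ∀ g g', (f (g * g')).1 = conj (fillingHol h g) (f g').1 + (f g).1 := fun g g' => by
    rw [hf, hf, hf]
    exact congrArg Subtype.val (cocycles₁_map_mul z g g')
  let zV : cocycles₁ (twistedV (fillingHol h)) :=
    ⟨fun g => (⟨symmPart (f g).1, symmPart_mem (f g).2⟩ : 𝔳),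
      (mem_cocycles₁_iff _).2 fun g g' => Subtype.ext (by
        change symmPart (f (g * g')).1 =
          conj (fillingHol h g) (symmPart (f g').1) + symmPart (f g).1
        rw [hval, symmPart_add, symmPart_conj])⟩
  obtain ⟨b, hb⟩ := (H1π_eq_zero_iff_exists _).1 (Subsingleton.elim (H1π _ zV) 0)
  have hb' : ∀ g, symmPart (f g).1 = conj (fillingHol h g) b.1 - b.1 := fun g =>
    congrArg Subtype.val (hb g)
  obtain ⟨B, hB, hB'⟩ := crossedHom_so31_principal hpq h (f := fun g => skewPart (f g).1)
    (fun g g' => by rw [hval, skewPart_add, skewPart_conj]) (fun g => skewPart_mem _)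
  -- `B` trivialises the `𝔰𝔬(3, 1)` component and `b` the `𝔳` component, so their sum trivialises
  -- `z`.
  refine (H1π_eq_zero_iff_exists _).2 ⟨(⟨B + b.1, add_mem hB b.2.1⟩ : sl4), fun g => ?_⟩
  rw [← hf]
  apply Subtype.ext
  change (f g).1 = conj (fillingHol h g) (B + b.1) - (B + b.1)
  rw [← skewPart_add_symmPart (f g).1, hB', hb', map_add]
  abel

end Shapes

end FigEight

end

theorem mainTheorem6 (S : FigEight.Shapes) (p q : ℤ) (hpq : IsCoprime p q)
    (hcoeff : S.IsDehnFillingCoeff p q)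
    (hdim : Module.finrank ℝ (groupCohomology.H1 S.𝔳u) = 1)
    (hx : Function.Bijective (S.resCircle FigEight.x))
    (hl : Function.Bijective (S.resCircle FigEight.l)) :
    (∃! s : ℝ, S.IsSlope s) ∧
    (S.slope ≠ -(q : ℝ) / (p : ℝ) →
      ∃ σ : FigEight.FilledGroup p q →* FigEight.SO31,
        (∀ g : FigEight.KnotGroup, σ (QuotientGroup.mk g) = S.hol g) ∧
        FigEight.InfinitesimallyProjectivelyRigid σ ∧
        Subsingleton (groupCohomology.H1 (FigEight.twistedV σ))) := by
  have hpq' : p ≠ 0 ∨ q ≠ 0 := hpq.ne_zero_or_ne_zero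
  refine ⟨S.existsUnique_isSlope (S.w_ne_one hcoeff) hdim hx hl, fun hs => ?_⟩
  have hV := S.subsingleton_H1_twistedV hdim hx hl hpq' hcoeff hs
  exact ⟨FigEight.Shapes.fillingHol hcoeff, FigEight.Shapes.fillingHol_mk hcoeff,
    FigEight.Shapes.rigid_of_subsingleton hpq' hcoeff hV, hV⟩
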